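/- Theorem 1. A convex curve in the plane is a curve $X\subset\mathbb R^2$ (a continuous image of a nonempty interval; it may be open or closed, e.g. a parabola or the unit circle) that meets every line in at most two points. Let $\mathcal S=(S_1,\dots,S_n)$ be a finite family of planar convex bodies (compact, convex, nonempty sets; repetitions are allowed). A transversal for $\mathcal S$ is a set $N\subset\mathbb R^2$ that intersects every member of $\mathcal S$. (a) If $X$ is a convex curve in the plane and every two members $S_i,S_j$ ($i\neq j$) of $\mathcal S$ meet at a point of $X$, then there is a point $z\in\mathbb R^2$ that lies in at least $n/15800$ of the members of $\mathcal S$, and $\mathcal S$ has a transversal of size at most $1.75\cdot 10^9$. (b) There are absolute constants $c,C>0$ such that the following holds for every integer $p\ge 2$, every convex curve $X$ in the plane and every such family $\mathcal S$. If among every $p$ members of $\mathcal S$ (that is, $p$ distinct indices) there are two that meet at a common point of $X$, then there is a point $z\in\mathbb R^2$ that lies in at least $c\,p^{-4}n$ of the members of $\mathcal S$, and $\mathcal S$ has a transversal of size at most $C\,p^{8}$. -/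

import Mathlib

/-- The Euclidean plane. -/
abbrev Plane : Type := EuclideanSpace ℝ (Fin 2)

/-- A plane curve, as a point set: a continuous image of a nonempty interval of the real line.
The interval may be open, half-open, closed, bounded or unbounded, and the parametrization need
not be injective, so open arcs and closed curves are both included. -/
def IsCurve (X : Set Plane) : Prop :=
  ∃ (I : Set ℝ) (γ : ℝ → Plane),
    I.OrdConnected ∧ I.Nonempty ∧ ContinuousOn γ I ∧ γ '' I = X

/-- A convex curve in the plane: a curve that meets every line in at most two points. -/
def IsConvexCurve (X : Set Plane) : Prop :=
  IsCurve X ∧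
    ∀ L : AffineSubspace ℝ Plane, Module.finrank ℝ L.direction = 1 →
      (X ∩ (L : Set Plane)).encard ≤ 2

/-- The convex bodies `A` and `B` meet at a point of `X`. -/
def MeetOn (X : Set Plane) (A B : ConvexBody Plane) : Prop :=
  ∃ x ∈ X, x ∈ A ∧ x ∈ B

/-- Among every `p` members of the family `S` (members are told apart by their indices, so that
repetitions are allowed) there are two that meet at a point of `X`. -/
def PairConditionOn (X : Set Plane) {n : ℕ} (S : Fin n → ConvexBody Plane) (p : ℕ) : Prop :=
  ∀ T : Finset (Fin n), T.card = p → ∃ i ∈ T, ∃ j ∈ T, i ≠ j ∧ MeetOn X (S i) (S j)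

/-- `N` is a transversal for the family `S`: it intersects every member of `S`. -/
def IsTransversal {n : ℕ} (S : Fin n → ConvexBody Plane) (N : Finset Plane) : Prop :=
  ∀ i, ∃ x ∈ N, x ∈ S i

/-!
Let `X` be a convex curve and `S` a family of convex bodies, many pairs of which meet on `X`.

*Convex position.* No point of `X` lies in the convex hull of the others (`notMem_convexHull_diff`).
By Carathéodory's theorem and the condition on lines, it suffices to exclude a point `d` of `X`
inside a triangle `a b c` of points of `X`. The lines through `d` and the vertices separate the
vertices from one another, so within `X` they are joined only through `d`; then a line parallel and
close to `a d` meets `X` in three points (`false_of_paths`).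

*A forced triple.* Some vertical line `ℓ` meets many of the hulls of `S i ∩ X`, by the
one-dimensional analogue of the problem (`exists_vertical_line`). Choose in each of these hulls a
point on `ℓ` and consider the pairs that meet on one side of `ℓ`. If two lower members (in the order
of the chosen points on `ℓ`) both meet two upper members there, in four distinct points, then three
of these four members have a common point, whatever the order of the four points along `X`
(`exists_triple_of_four_cycle`). So a subfamily without triples containing a meeting pair has no
4-cycle of this kind, and by the Kővári–Sós–Turán argument the number of pairs meeting on `X` is at
most `3 T + O(N ^ (3 / 2))`, where `N` is the number of members and `T` the number of triples with a
common point (`card_meeting_two_le`).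

*Deep points.* Under the `p`-condition, `N` members span at least about `N ^ 2 / (4 p)` meeting
pairs. With `N` of order `p ^ 2` this beats `N ^ (3 / 2)`, so every `N` members have at least about
`p ^ 3` triples with a common point; averaging over all `N`-subsets, a fraction of order `p ^ (-3)`
of all triples among the members hit by `ℓ` have a common point. A fractional Helly theorem
(`exists_deep_point_of_triples`) gives a point in the same fraction of these members, hence in a
fraction of order `p ^ (-4)` of all members. For part (a) all pairs meet, and `N = 36` suffices.

*Transversals.* The hypotheses survive repeating members, so deep points exist for all
multiplicities. Reweighting (`exists_sequence`) turns them into finitely many points such that every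
member contains a fixed fraction of them, and a weak net of these points (`exists_weak_net`), of size
quadratic in the inverse of the fraction, is a transversal.
-/

/-! ### Convex curves are in convex position -/

/-- Twice the signed area of the triangle `a b c`: positive if `a`, `b`, `c` turn
counterclockwise, zero if they are collinear. -/
def orient (a b c : Plane) : ℝ :=
  (b 0 - a 0) * (c 1 - a 1) - (b 1 - a 1) * (c 0 - a 0)

theorem Plane.ext_coord {a b : Plane} (h0 : a 0 = b 0) (h1 : a 1 = b 1) : a = b := by
  ext i
  fin_cases i
  · exact h0
  · exact h1

theorem continuous_orient (a b : Plane) : Continuous (orient a b) := by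
  unfold orient
  fun_prop

theorem orient_ne_zero {X : Set Plane} (hX : IsConvexCurve X) {a b c : Plane} (ha : a ∈ X)
    (hb : b ∈ X) (hc : c ∈ X) (hab : a ≠ b) (hac : a ≠ c) (hbc : b ≠ c) : orient a b c ≠ 0 := by
  intro h
  have hfin : Module.finrank ℝ (line[ℝ, a, b]).direction = 1 := by
    rw [direction_affineSpan, vectorSpan_pair_rev]
    exact finrank_span_singleton (by simpa [sub_eq_zero] using hab.symm)
  have hcL : c ∈ line[ℝ, a, b] := by
    have key : ∃ t : ℝ, c = AffineMap.lineMap a b t := by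
      unfold orient at h
      by_cases h0 : b 0 - a 0 = 0
      · have h1 : b 1 - a 1 ≠ 0 := by
          intro h1
          exact hab (Plane.ext_coord (by linarith) (by linarith))
        refine ⟨(c 1 - a 1) / (b 1 - a 1), Plane.ext_coord ?_ ?_⟩
        · rw [h0] at h
          have h2 : c 0 - a 0 = 0 := by
            rcases mul_eq_zero.1 (show (b 1 - a 1) * (c 0 - a 0) = 0 by linarith) with h2 | h2
            · exact absurd h2 h1
            · exact h2
          simp [AffineMap.lineMap_apply, h0]
          linarith
        · simp [AffineMap.lineMap_apply]
          field_simp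
          ring
      · refine ⟨(c 0 - a 0) / (b 0 - a 0), Plane.ext_coord ?_ ?_⟩
        · simp [AffineMap.lineMap_apply]
          field_simp
          ring
        · simp [AffineMap.lineMap_apply]
          field_simp
          linarith
    obtain ⟨t, rfl⟩ := key
    exact AffineMap.lineMap_mem_affineSpan_pair t a b
  have hsub : ({a, b, c} : Set Plane) ⊆ X ∩ (line[ℝ, a, b] : Set Plane) := by
    rintro x (rfl | rfl | rfl)
    · exact ⟨ha, left_mem_affineSpan_pair ℝ _ _⟩
    · exact ⟨hb, right_mem_affineSpan_pair ℝ _ _⟩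
    · exact ⟨hc, hcL⟩
  have h3 : ({a, b, c} : Set Plane).encard = 3 := Set.encard_eq_three.2 ⟨a, b, c, hab, hac, hbc, rfl⟩
  have := (Set.encard_le_encard hsub).trans (hX.2 _ hfin)
  rw [h3] at this
  exact absurd this (by decide)

theorem IsCurve.isPathConnected {X : Set Plane} (hX : IsCurve X) : IsPathConnected X := by
  obtain ⟨I, γ, hI, hne, hγ, rfl⟩ := hX
  exact (hI.convex.isPathConnected hne).image' hγ

theorem joinedIn_of_curve {F : Set Plane} {γ : ℝ → Plane} (hγ : Continuous γ) {s t : ℝ}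
    (h : ∀ u ∈ Set.uIcc s t, γ u ∈ F) : JoinedIn F (γ s) (γ t) := by
  have h1 : IsPathConnected (γ '' Set.uIcc s t) :=
    ((convex_uIcc s t).isPathConnected ⟨s, Set.left_mem_uIcc⟩).image hγ
  refine (h1.joinedIn _ ⟨s, Set.left_mem_uIcc, rfl⟩ _ ⟨t, Set.right_mem_uIcc, rfl⟩).mono ?_
  rintro _ ⟨u, hu, rfl⟩
  exact h u hu

/-- A line through two points `c`, `d` of a convex curve separates the rest of the curve: a path
in the curve from one side to the other passes through `c` or `d`. -/
theorem orient_mul_pos_of_joinedIn {X : Set Plane} (hX : IsConvexCurve X) {a b c d : Plane}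
    (hc : c ∈ X) (hd : d ∈ X) (hcd : c ≠ d) (h : JoinedIn (X \ {c, d}) a b) :
    0 < orient c d a * orient c d b := by
  obtain ⟨γ, hγ⟩ := h
  have hne : ∀ t, orient c d (γ t) ≠ 0 := by
    intro t
    have h1 := hγ t
    simp only [Set.mem_sdiff, Set.mem_insert_iff, Set.mem_singleton_iff, not_or] at h1
    exact orient_ne_zero hX hc hd h1.1 hcd (Ne.symm h1.2.1) (Ne.symm h1.2.2)
  have hcont : Continuous fun t => orient c d (γ t) := (continuous_orient c d).comp γ.continuous
  by_contra hle
  have h0 : orient c d a ≠ 0 := by simpa using hne 0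
  have h1 : orient c d b ≠ 0 := by simpa using hne 1
  have hlt : orient c d a * orient c d b < 0 := lt_of_le_of_ne (not_lt.1 hle) (mul_ne_zero h0 h1)
  have : (0 : ℝ) ∈ Set.range fun t => orient c d (γ t) := by
    rcases mul_neg_iff.1 hlt with ⟨h2, h3⟩ | ⟨h2, h3⟩
    · exact mem_range_of_exists_le_of_exists_ge hcont ⟨1, by simpa using h3.le⟩
        ⟨0, by simpa using h2.le⟩
    · exact mem_range_of_exists_le_of_exists_ge hcont ⟨0, by simpa using h2.le⟩
        ⟨1, by simpa using h3.le⟩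
  obtain ⟨t, ht⟩ := this
  exact hne t ht

/-- If no path of `X` leads from `a` to `b` or `c` before meeting the other marked points, then
some path of `X` leads from `a` to `d` with no marked point in between. -/
theorem exists_clean_path {X : Set Plane} (hX : IsPathConnected X) {a b c d : Plane}
    (ha : a ∈ X) (hd : d ∈ X) (had : a ≠ d) (hbc : b ≠ c) (hbd : b ≠ d) (hcd : c ≠ d)
    (h1 : ¬ JoinedIn (X \ {c, d}) a b) (h2 : ¬ JoinedIn (X \ {b, d}) a c) :
    ∃ (γ : ℝ → Plane) (s t : ℝ), Continuous γ ∧ s < t ∧ γ s = a ∧ γ t = d ∧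
      (∀ u ∈ Set.Icc s t, γ u ∈ X) ∧ (∀ u ∈ Set.Ioo s t, γ u ∉ ({a, b, c, d} : Set Plane)) := by
  obtain ⟨p, hp⟩ := hX.joinedIn a ha d hd
  set γ : ℝ → Plane := fun u => p.extend u with hγdef
  have hγ : Continuous γ := p.extend.continuous
  have hγX : ∀ u, γ u ∈ X := by
    intro u
    have : γ u ∈ Set.range p := by
      rw [← p.extend_range]; exact ⟨u, rfl⟩
    obtain ⟨v, hv⟩ := this
    rw [← hv]; exact hp v
  have hγ0 : γ 0 = a := by simp [hγdef]
  have hγ1 : γ 1 = d := by simp [hγdef]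
  -- the first time `t` at which `b`, `c` or `d` is reached
  have hK : IsCompact (Set.Icc (0 : ℝ) 1 ∩ γ ⁻¹' {b, c, d}) :=
    isCompact_Icc.inter_right (((Set.toFinite ({b, c, d} : Set Plane)).isClosed).preimage hγ)
  obtain ⟨t, ⟨⟨ht0, ht1⟩, htm⟩, htmin⟩ := hK.exists_isLeast ⟨1, ⟨by norm_num, by simp [hγ1]⟩⟩
  have hbefore : ∀ u ∈ Set.Icc 0 t, γ u ∈ ({b, c, d} : Set Plane) → γ u = γ t := by
    intro u hu hum
    have : t ≤ u := htmin ⟨⟨hu.1, hu.2.trans ht1⟩, hum⟩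
    rw [le_antisymm hu.2 this]
  have htd : γ t = d := by
    rcases htm with h | h | h
    · exfalso
      apply h1
      have := joinedIn_of_curve (F := X \ {c, d}) hγ (s := 0) (t := t) (by
        intro u hu
        rw [Set.uIcc_of_le ht0] at hu
        refine ⟨hγX u, ?_⟩
        rintro (h' | h')
        · have := hbefore u hu (by simp [h'])
          exact hbc (by rw [← h, ← this, h'])
        · have h' : γ u = d := h'
          have := hbefore u hu (by simp [h'])
          exact hbd (by rw [← h, ← this, h']))
      rwa [hγ0, h] at this
    · exfalso
      apply h2
      have := joinedIn_of_curve (F := X \ {b, d}) hγ (s := 0) (t := t) (by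
        intro u hu
        rw [Set.uIcc_of_le ht0] at hu
        refine ⟨hγX u, ?_⟩
        rintro (h' | h')
        · have := hbefore u hu (by simp [h'])
          exact hbc (by rw [← h, ← this, h'])
        · have h' : γ u = d := h'
          have := hbefore u hu (by simp [h'])
          exact hcd (by rw [← h, ← this, h']))
      rwa [hγ0, h] at this
    · exact h
  -- the last time `s` before `t` at which `a` is visited
  have hK' : IsCompact (Set.Icc (0 : ℝ) t ∩ γ ⁻¹' {a}) :=
    isCompact_Icc.inter_right (isClosed_singleton.preimage hγ)
  obtain ⟨s, ⟨⟨hs0, hst⟩, hsa⟩, hsmax⟩ := hK'.exists_isGreatest ⟨0, ⟨⟨le_rfl, ht0⟩, hγ0⟩⟩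
  have hsa : γ s = a := hsa
  have hst' : s < t := lt_of_le_of_ne hst (by rintro rfl; exact had (hsa.symm.trans htd))
  refine ⟨γ, s, t, hγ, hst', hsa, htd, fun u _ => hγX u, ?_⟩
  rintro u ⟨hu1, hu2⟩ hu
  rcases Set.mem_insert_iff.1 hu with h | h
  · exact absurd (hsmax ⟨⟨hs0.trans hu1.le, hu2.le⟩, h⟩) (not_le.2 hu1)
  · exact absurd (htmin ⟨⟨hs0.trans hu1.le, hu2.le.trans ht1⟩, h⟩) (not_le.2 hu2)

theorem orient_eq_zero_of_eq {a d x y z : Plane} (had : a ≠ d)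
    (hxy : orient a d x = orient a d y) (hxz : orient a d x = orient a d z) :
    orient x y z = 0 := by
  unfold orient at *
  by_cases h0 : d 0 - a 0 = 0
  · have h1 : d 1 - a 1 ≠ 0 := by
      intro h1
      exact had (Plane.ext_coord (by linarith) (by linarith))
    apply mul_left_cancel₀ h1
    linear_combination (z 1 - x 1) * hxy - (y 1 - x 1) * hxz
  · apply mul_left_cancel₀ h0
    linear_combination (y 0 - x 0) * hxz * (-1) + (z 0 - x 0) * hxy

/-- The level line argument: a path of the curve from `a` to `d` running on the side of `b` of the
line `a d`, together with a path from `b` to `d`, meets a line parallel and close to `a d` in three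
points. -/
theorem false_of_paths {X : Set Plane} (hX : IsConvexCurve X) {a b c d : Plane}
    (hac : a ≠ c) (had : a ≠ d) (hbc : b ≠ c) (hbd : b ≠ d)
    (hnj : ¬ JoinedIn (X \ {c, d}) a b)
    {γ δ : ℝ → Plane} {s t s' t' τ : ℝ} (hγ : Continuous γ) (hst : s < t)
    (hγs : γ s = a) (hγt : γ t = d) (hγX : ∀ u ∈ Set.Icc s t, γ u ∈ X)
    (hγm : ∀ u ∈ Set.Ioo s t, γ u ∉ ({a, b, c, d} : Set Plane))
    (hδ : Continuous δ) (hst' : s' < t')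
    (hδs : δ s' = b) (hδt : δ t' = d) (hδX : ∀ u ∈ Set.Icc s' t', δ u ∈ X)
    (hδm : ∀ u ∈ Set.Ioo s' t', δ u ∉ ({b, a, c, d} : Set Plane))
    (hτ : τ ∈ Set.Ioo s t) (hside : 0 < orient a d b * orient a d (γ τ)) : False := by
  have haX : a ∈ X := hγs ▸ hγX s ⟨le_rfl, hst.le⟩
  have hdX : d ∈ X := hγt ▸ hγX t ⟨hst.le, le_rfl⟩
  set f : Plane → ℝ := fun z => orient a d b * orient a d z with hf
  have hfc : Continuous f := continuous_const.mul (continuous_orient a d)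
  have hob : orient a d b ≠ 0 := fun h => by simp [h] at hside
  have hfb : 0 < f b := by
    have := mul_self_pos.2 hob
    simpa [hf] using this
  have hfa : f a = 0 := by simp [hf, orient]
  have hfd : f d = 0 := by simp only [hf, orient]; ring
  have hfγ : ∀ u ∈ Set.Ioo s t, 0 < f (γ u) := by
    intro u hu
    have hne : ∀ v ∈ Set.Ioo s t, γ v ∈ X \ {a, d} := by
      intro v hv
      refine ⟨hγX v ⟨hv.1.le, hv.2.le⟩, fun h => hγm v hv ?_⟩
      rcases h with h | h
      · simp [h]
      · have h : γ v = d := h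
        simp [h]
    have hj : JoinedIn (X \ {a, d}) (γ u) (γ τ) := joinedIn_of_curve hγ fun v hv =>
      hne v (Set.OrdConnected.uIcc_subset Set.ordConnected_Ioo hu hτ hv)
    have h1 := orient_mul_pos_of_joinedIn hX haX hdX had hj
    have h2 : 0 < (orient a d b * orient a d (γ u)) * (orient a d (γ τ)) ^ 2 := by
      have := mul_pos hside h1
      nlinarith
    exact (pos_iff_pos_of_mul_pos h2).2 (by
      have : orient a d (γ τ) ≠ 0 := fun h => by simp [h] at hside
      positivity)
  obtain ⟨Ua, Ud, hUa, hUd, haU, hdU, hdisj⟩ := t2_separation had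
  have hev1 : ∀ᶠ u in nhdsWithin s (Set.Ioi s), γ u ∈ Ua ∧ u < t := by
    have h1 : ∀ᶠ u in nhds s, γ u ∈ Ua :=
      hγ.continuousAt.eventually (hUa.mem_nhds (by rwa [hγs]))
    exact (h1.filter_mono nhdsWithin_le_nhds).and
      (mem_nhdsWithin_of_mem_nhds (Iio_mem_nhds hst))
  obtain ⟨u, hu1, hu2⟩ := mem_nhdsGT_iff_exists_Ioo_subset.1 hev1
  have hev2 : ∀ᶠ v in nhdsWithin t (Set.Iio t), γ v ∈ Ud ∧ s < v := by
    have h1 : ∀ᶠ u in nhds t, γ u ∈ Ud :=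
      hγ.continuousAt.eventually (hUd.mem_nhds (by rwa [hγt]))
    exact (h1.filter_mono nhdsWithin_le_nhds).and
      (mem_nhdsWithin_of_mem_nhds (Ioi_mem_nhds hst))
  obtain ⟨v, hv1, hv2⟩ := mem_nhdsLT_iff_exists_Ioo_subset.1 hev2
  obtain ⟨u', hu'⟩ := exists_between (show s < u from hu1)
  obtain ⟨v', hv'⟩ := exists_between (show v < t from hv1)
  have hu't : u' < t := (hu2 hu').2
  have hv's : s < v' := (hv2 hv').2
  obtain ⟨ε, hε0, hε⟩ := exists_between
    (lt_min (lt_min (hfγ u' ⟨hu'.1, hu't⟩) (hfγ v' ⟨hv's, hv'.2⟩)) hfb)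
  obtain ⟨hε12, hε3⟩ := lt_min_iff.1 hε
  obtain ⟨hε1, hε2⟩ := lt_min_iff.1 hε12
  obtain ⟨x, hx, hxε⟩ := intermediate_value_Ioo hu'.1.le (hfc.comp hγ).continuousOn
    (show ε ∈ Set.Ioo ((f ∘ γ) s) ((f ∘ γ) u') by simp [hγs, hfa, hε0, hε1])
  obtain ⟨y, hy, hyε⟩ := intermediate_value_Ioo' hv'.2.le (hfc.comp hγ).continuousOn
    (show ε ∈ Set.Ioo ((f ∘ γ) t) ((f ∘ γ) v') by simp [hγt, hfd, hε0, hε2])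
  obtain ⟨w, hw, hwε⟩ := intermediate_value_Ioo' hst'.le (hfc.comp hδ).continuousOn
    (show ε ∈ Set.Ioo ((f ∘ δ) t') ((f ∘ δ) s') by simp [hδt, hδs, hfd, hε0, hε3])
  have hxU : γ x ∈ Ua := (hu2 ⟨hx.1, hx.2.trans hu'.2⟩).1
  have hyU : γ y ∈ Ud := (hv2 ⟨hv'.1.trans hy.1, hy.2⟩).1
  have hxI : x ∈ Set.Ioo s t := ⟨hx.1, hx.2.trans hu't⟩
  have hyI : y ∈ Set.Ioo s t := ⟨hv's.trans hy.1, hy.2⟩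
  have hdis : ∀ z ∈ Set.Ioo s t, γ z ≠ δ w := by
    intro z hz hzw
    apply hnj
    have j1 : JoinedIn (X \ {c, d}) a (γ z) := by
      rw [← hγs]
      apply joinedIn_of_curve hγ
      intro r hr
      rw [Set.uIcc_of_le hz.1.le] at hr
      refine ⟨hγX r ⟨hr.1, hr.2.trans hz.2.le⟩, fun h => ?_⟩
      rcases eq_or_lt_of_le hr.1 with h0 | h0
      · rw [← h0, hγs] at h
        rcases h with h | h
        exacts [hac h, had h]
      · exact hγm r ⟨h0, hr.2.trans_lt hz.2⟩ (by
          rcases h with h | h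
          · simp [h]
          · have h : γ r = d := h
            simp [h])
    have j2 : JoinedIn (X \ {c, d}) (δ w) b := by
      rw [← hδs]
      apply JoinedIn.symm
      apply joinedIn_of_curve hδ
      intro r hr
      rw [Set.uIcc_of_le hw.1.le] at hr
      refine ⟨hδX r ⟨hr.1, hr.2.trans hw.2.le⟩, fun h => ?_⟩
      rcases eq_or_lt_of_le hr.1 with h0 | h0
      · rw [← h0, hδs] at h
        rcases h with h | h
        exacts [hbc h, hbd h]
      · exact hδm r ⟨h0, hr.2.trans_lt hw.2⟩ (by
          rcases h with h | h
          · simp [h]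
          · have h : δ r = d := h
            simp [h])
    rw [← hzw] at j2
    exact j1.trans j2
  have hxy : γ x ≠ γ y := fun h => Set.disjoint_left.1 hdisj hxU (h ▸ hyU)
  have e1 : orient a d (γ x) = orient a d (γ y) := by
    have : f (γ x) = f (γ y) := hxε.trans hyε.symm
    exact mul_left_cancel₀ hob this
  have e2 : orient a d (γ x) = orient a d (δ w) := by
    have : f (γ x) = f (δ w) := hxε.trans hwε.symm
    exact mul_left_cancel₀ hob this
  exact orient_ne_zero hX (hγX x ⟨hxI.1.le, hxI.2.le⟩) (hγX y ⟨hyI.1.le, hyI.2.le⟩)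
    (hδX w ⟨hw.1.le, hw.2.le⟩) hxy (hdis x hxI) (hdis y hyI) (orient_eq_zero_of_eq had e1 e2)

/-- No point of a convex curve lies inside a triangle spanned by three other points of it. -/
theorem false_of_mem_triangle {X : Set Plane} (hX : IsConvexCurve X) {a b c d : Plane}
    (ha : a ∈ X) (hb : b ∈ X) (hc : c ∈ X) (hd : d ∈ X) (hab : a ≠ b) (hac : a ≠ c) (hbc : b ≠ c)
    (had : a ≠ d) (hbd : b ≠ d) (hcd : c ≠ d)
    {α β κ : ℝ} (hα : 0 < α) (hβ : 0 < β) (hκ : 0 < κ) (hsum : α + β + κ = 1)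
    (h0 : d 0 = α * a 0 + β * b 0 + κ * c 0) (h1 : d 1 = α * a 1 + β * b 1 + κ * c 1) : False := by
  have hα' : α = 1 - β - κ := by linarith
  have hpc := hX.1.isPathConnected
  have hD : orient a b c ≠ 0 := orient_ne_zero hX ha hb hc hab hac hbc
  have hDD : 0 < orient a b c ^ 2 := by positivity
  have e1 : orient a d b * orient a d c = -(β * κ) * orient a b c ^ 2 := by
    simp only [orient, h0, h1, hα']; ring
  have e2 : orient b d a * orient b d c = -(α * κ) * orient a b c ^ 2 := by
    simp only [orient, h0, h1, hα']; ring
  have e3 : orient c d a * orient c d b = -(α * β) * orient a b c ^ 2 := by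
    simp only [orient, h0, h1, hα']; ring
  have n1 : ∀ {x y z : Plane}, z ∈ X → z ≠ d → orient z d x * orient z d y < 0 →
      ¬ JoinedIn (X \ {z, d}) x y := fun hz hzd hneg hj =>
    lt_asymm hneg (orient_mul_pos_of_joinedIn hX hz hd hzd hj)
  have m1 : orient a d b * orient a d c < 0 := by rw [e1]; nlinarith [mul_pos hβ hκ]
  have m2 : orient b d a * orient b d c < 0 := by rw [e2]; nlinarith [mul_pos hα hκ]
  have m3 : orient c d a * orient c d b < 0 := by rw [e3]; nlinarith [mul_pos hα hβ]
  have jbc := n1 ha had m1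
  have jac := n1 hb hbd m2
  have jab := n1 hc hcd m3
  obtain ⟨γ, s, t, hγ, hst, hγs, hγt, hγX, hγm⟩ :=
    exists_clean_path hpc ha hd had hbc hbd hcd jab jac
  obtain ⟨δ, s', t', hδ, hst', hδs, hδt, hδX, hδm⟩ :=
    exists_clean_path hpc hb hd hbd hac had hcd (fun h => jab h.symm) jbc
  obtain ⟨η, s'', t'', hη, hst'', hηs, hηt, hηX, hηm⟩ :=
    exists_clean_path hpc hc hd hcd hab had hbd (fun h => jac h.symm)
      (fun h => jbc h.symm)
  obtain ⟨τ, hτ⟩ := exists_between hst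
  have hτm := hγm τ hτ
  simp only [Set.mem_insert_iff, Set.mem_singleton_iff, not_or] at hτm
  have hne : orient a d (γ τ) ≠ 0 := orient_ne_zero hX ha hd (hγX τ ⟨hτ.1.le, hτ.2.le⟩) had
    (Ne.symm hτm.1) (Ne.symm hτm.2.2.2)
  rcases lt_or_gt_of_ne (mul_ne_zero (left_ne_zero_of_mul m1.ne) hne) with hlt | hgt
  · have hside : 0 < orient a d c * orient a d (γ τ) := by
      have h2 : 0 < (orient a d b * orient a d c) * (orient a d b * orient a d (γ τ)) :=
        mul_pos_of_neg_of_neg m1 hlt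
      have h3 : 0 < (orient a d b) ^ 2 := by
        have := left_ne_zero_of_mul m1.ne
        positivity
      have h4 : 0 < (orient a d b) ^ 2 * (orient a d c * orient a d (γ τ)) := by linarith
      exact (pos_iff_pos_of_mul_pos h4).1 h3
    refine false_of_paths hX hab had hbc.symm hcd jac hγ hst hγs hγt hγX ?_ hη hst'' hηs hηt
      hηX hηm hτ hside
    intro u hu h
    refine hγm u hu ?_
    simp only [Set.mem_insert_iff, Set.mem_singleton_iff] at h ⊢
    tauto
  · exact false_of_paths hX hac had hbc hbd jab hγ hst hγs hγt hγX hγm hδ hst' hδs hδt hδX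
      hδm hτ hgt

/-- A convex curve is in convex position. -/
theorem notMem_convexHull_diff {X : Set Plane} (hX : IsConvexCurve X) {p : Plane} (hp : p ∈ X) :
    p ∉ convexHull ℝ (X \ {p}) := by
  intro h
  obtain ⟨ι, hι, z, w, hz, hai, hw, hw1, hzp⟩ := eq_pos_convex_span_of_mem_convexHull h
  have hcard : Fintype.card ι ≤ 3 := by
    have := hai.card_le_finrank_succ
    have h2 : Module.finrank ℝ (vectorSpan ℝ (Set.range z)) ≤ 2 := by
      have := Submodule.finrank_le (vectorSpan ℝ (Set.range z))
      simpa using this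
    omega
  have hmem : ∀ i, z i ∈ X ∧ p ≠ z i := fun i => by
    have := hz ⟨i, rfl⟩
    exact ⟨this.1, fun h => this.2 h.symm⟩
  obtain ⟨k, e⟩ : ∃ k, Nonempty (Fin k ≃ ι) := ⟨_, ⟨(Fintype.equivFin ι).symm⟩⟩
  obtain ⟨e⟩ := e
  have hinj : ∀ {i j : Fin k}, i ≠ j → z (e i) ≠ z (e j) := fun hij h =>
    hij (e.injective (hai.injective h))
  have hk : k ≤ 3 := by
    rw [← Fintype.card_congr e] at hcard
    simpa using hcard
  rw [← e.sum_comp] at hw1 hzp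
  have hc : ∀ l : Fin 2, p l = ∑ i, w (e i) * z (e i) l := by
    intro l
    rw [← hzp]
    simp
  interval_cases k
  · simp at hw1
  · simp only [Finset.univ_unique, Fin.default_eq_zero, Finset.sum_singleton] at hw1 hc
    exact (hmem (e 0)).2 (Plane.ext_coord (by rw [hc, hw1, one_mul]) (by rw [hc, hw1, one_mul]))
  · simp only [Fin.sum_univ_two] at hw1 hc
    refine orient_ne_zero hX hp (hmem (e 0)).1 (hmem (e 1)).1 (hmem _).2 (hmem _).2
      (hinj (by decide)) ?_
    have hw1' : w (e 0) = 1 - w (e 1) := by linarith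
    simp only [orient, hc, hw1']
    ring
  · simp only [Fin.sum_univ_three] at hw1 hc
    exact false_of_mem_triangle hX (hmem (e 0)).1 (hmem (e 1)).1 (hmem (e 2)).1 hp
      (hinj (by decide)) (hinj (by decide)) (hinj (by decide)) (Ne.symm (hmem _).2)
      (Ne.symm (hmem _).2) (Ne.symm (hmem _).2) (hw _) (hw _) (hw _) hw1 (hc 0) (hc 1)

/-! ### Points on one side of a line -/

theorem convex_convexHull_diff {X : Set Plane} (hX : IsConvexCurve X) {p : Plane} (hp : p ∈ X) :
    Convex ℝ (convexHull ℝ X \ {p}) := by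
  refine ((convex_convexHull ℝ X).mem_extremePoints_iff_convex_sdiff.1 ?_).2
  rw [mem_extremePoints]
  refine ⟨subset_convexHull ℝ X hp, fun u hu v hv hpuv => ?_⟩
  by_cases hne : (X \ {p}).Nonempty
  · have hins : X = insert p (X \ {p}) := by simp [Set.insert_eq_of_mem hp]
    rw [hins, convexHull_insert hne] at hu hv
    simp only [convexJoin_singleton_left, Set.mem_iUnion] at hu hv
    obtain ⟨u', hu', s, s', hs, hs', hss, rfl⟩ := hu
    obtain ⟨v', hv', t, t', ht, ht', htt, rfl⟩ := hv
    obtain ⟨a, b, ha, hb, hab, hpe⟩ := hpuv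
    have hcoef : a * s' + b * t' = 0 := by
      by_contra h0
      have hpos : 0 < a * s' + b * t' := lt_of_le_of_ne (by positivity) (Ne.symm h0)
      refine notMem_convexHull_diff hX hp ?_
      have hK := convex_convexHull ℝ (X \ {p})
      have := hK hu' hv' (div_nonneg (mul_nonneg ha.le hs') hpos.le)
        (div_nonneg (mul_nonneg hb.le ht') hpos.le) (by field_simp)
      convert this using 1
      have e : (a * s' + b * t') • p = (a * s') • u' + (b * t') • v' := by
        have h1 : a * s' + b * t' = 1 - a * s - b * t := by
          have e1 : s' = 1 - s := by linarith
          have e2 : t' = 1 - t := by linarith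
          rw [e1, e2]; linarith
        rw [h1, sub_smul, sub_smul, one_smul]
        nth_rewrite 1 [← hpe]
        simp only [smul_add, smul_smul]
        abel
      rw [div_eq_inv_mul, div_eq_inv_mul, mul_smul _ (a * s'), mul_smul _ (b * t'), ← smul_add, ← e,
        smul_smul, inv_mul_cancel₀ h0, one_smul]
    have h1 : s' = 0 := by nlinarith [mul_nonneg ha.le hs', mul_nonneg hb.le ht']
    have h2 : t' = 0 := by nlinarith [mul_nonneg ha.le hs', mul_nonneg hb.le ht']
    have h3 : s = 1 := by linarith
    have h4 : t = 1 := by linarith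
    simp [h1, h2, h3, h4]
  · have hXp : X = {p} := Set.Subset.antisymm (fun z hz => by
      by_contra h
      exact hne ⟨z, hz, h⟩) (by simpa using hp)
    rw [hXp, convexHull_singleton] at hu hv
    exact ⟨hu, hv⟩

theorem Convex.mem_of_three {K : Set Plane} (hK : Convex ℝ K) {x y z u : Plane} (hx : x ∈ K)
    (hy : y ∈ K) (hz : z ∈ K) {a b c : ℝ} (ha : 0 ≤ a) (hb : 0 ≤ b) (hc : 0 ≤ c)
    (hpos : 0 < a + b + c) (h0 : (a + b + c) * u 0 = a * x 0 + b * y 0 + c * z 0)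
    (h1 : (a + b + c) * u 1 = a * x 1 + b * y 1 + c * z 1) : u ∈ K := by
  have h := hK.sum_mem (t := Finset.univ) (w := ![a / (a + b + c), b / (a + b + c), c / (a + b + c)])
    (z := ![x, y, z])
    (by intro i _; fin_cases i <;> simp <;> positivity)
    (by simp [Fin.sum_univ_three]; field_simp)
    (by intro i _; fin_cases i <;> simp [hx, hy, hz])
  convert h using 1
  simp only [Fin.sum_univ_three]
  apply Plane.ext_coord
  · simp; field_simp; linarith
  · simp; field_simp; linarith

/-- A line through two points `p`, `q` of the curve on the same side of the vertical line `z 0 = c`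
misses the part of the vertical line inside the hull of the curve. -/
theorem orient_anchor_ne_zero {X : Set Plane} (hX : IsConvexCurve X) {w p q : Plane}
    (hw : w ∈ convexHull ℝ X) (hp : p ∈ X) (hq : q ∈ X) (hpq : p ≠ q)
    (hside : 0 < (w 0 - p 0) * (w 0 - q 0)) : orient w p q ≠ 0 := by
  intro h
  -- the point closer to the line would lie between the other one and `w`
  have key : ∀ p q : Plane, p ∈ X → q ∈ X → p ≠ q → 0 < (w 0 - p 0) * (w 0 - q 0) →
      orient w p q = 0 → (w 0 - p 0) ^ 2 < (w 0 - q 0) * (w 0 - p 0) → False := by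
    intro p q hp hq hpq hside h hlt
    have hp0 : w 0 - p 0 ≠ 0 := left_ne_zero_of_mul hside.ne'
    have hwp : w ≠ p := by rintro rfl; simp at hp0
    refine ((convex_convexHull_diff hX hp).mem_of_three (u := p) (x := w) (y := q) (z := q)
      ⟨hw, hwp⟩ ⟨subset_convexHull ℝ X hq, hpq.symm⟩ ⟨subset_convexHull ℝ X hq, hpq.symm⟩
      (a := (w 0 - q 0) * (w 0 - p 0) - (w 0 - p 0) ^ 2)
      (b := (w 0 - p 0) ^ 2) (c := 0) (by linarith) (by positivity) le_rfl (by nlinarith) ?_ ?_).2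
      rfl
    · ring
    · unfold orient at h
      linear_combination (w 0 - p 0) * h
  rcases lt_trichotomy ((w 0 - p 0) ^ 2) ((w 0 - q 0) * (w 0 - p 0)) with h1 | h1 | h1
  · exact key p q hp hq hpq hside h h1
  · have hp0 : w 0 - p 0 ≠ 0 := left_ne_zero_of_mul hside.ne'
    have e : w 0 - p 0 = w 0 - q 0 := mul_right_cancel₀ hp0 (by linarith)
    refine hpq (Plane.ext_coord (by linarith) ?_)
    unfold orient at h
    have hq0 : q 0 = p 0 := by linarith
    rw [hq0] at h
    exact mul_left_cancel₀ hp0 (by linear_combination h)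
  · refine key q p hq hp hpq.symm (by linarith) ?_ ?_
    · unfold orient at *; linarith
    · have hs : (0 : ℝ) < (w 0 - p 0) * (w 0 - q 0) := hside
      have h2 : (w 0 - q 0) * (w 0 - p 0) * (w 0 - q 0) ^ 2 < (w 0 - p 0) ^ 2 * (w 0 - q 0) ^ 2 := by
        have : 0 < (w 0 - q 0) ^ 2 := by
          have := right_ne_zero_of_mul hside.ne'
          positivity
        nlinarith
      have h3 : ((w 0 - p 0) * (w 0 - q 0)) * (w 0 - q 0) ^ 2 <
          ((w 0 - p 0) * (w 0 - q 0)) * ((w 0 - p 0) * (w 0 - q 0)) := by linarith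
      exact lt_of_mul_lt_mul_left h3 hs.le

/-- The angular order of two points of the curve on one side of a vertical line is the same from
all points of that line in the hull of the curve. -/
theorem orient_anchor_mul_pos {X : Set Plane} (hX : IsConvexCurve X) {x y p q : Plane} {c : ℝ}
    (hx : x ∈ convexHull ℝ X) (hy : y ∈ convexHull ℝ X) (hx0 : x 0 = c) (hy0 : y 0 = c)
    (hp : p ∈ X) (hq : q ∈ X) (hpq : p ≠ q) (hside : 0 < (c - p 0) * (c - q 0)) :
    0 < orient x p q * orient y p q := by
  by_contra hle
  have nx := orient_anchor_ne_zero hX hx hp hq hpq (by rwa [hx0])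
  have ny := orient_anchor_ne_zero hX hy hp hq hpq (by rwa [hy0])
  have hlt : orient x p q * orient y p q < 0 := lt_of_le_of_ne (not_lt.1 hle) (mul_ne_zero nx ny)
  have hd : orient y p q - orient x p q ≠ 0 := by
    intro h
    rw [sub_eq_zero.1 h] at hlt
    nlinarith [mul_self_nonneg (orient x p q)]
  have hd2 : 0 < (orient y p q - orient x p q) ^ 2 := by positivity
  set s := orient y p q / (orient y p q - orient x p q) with hs
  have hs0 : 0 ≤ s := by
    rw [hs, show orient y p q / (orient y p q - orient x p q) =
      (orient y p q * (orient y p q - orient x p q)) / (orient y p q - orient x p q) ^ 2 by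
        field_simp]
    apply div_nonneg _ hd2.le
    nlinarith [mul_self_nonneg (orient y p q)]
  have hs1 : 0 ≤ 1 - s := by
    rw [hs, show 1 - orient y p q / (orient y p q - orient x p q) =
      (-orient x p q * (orient y p q - orient x p q)) / (orient y p q - orient x p q) ^ 2 by
        field_simp; ring]
    apply div_nonneg _ hd2.le
    nlinarith [mul_self_nonneg (orient x p q)]
  have hw : s • x + (1 - s) • y ∈ convexHull ℝ X :=
    convex_convexHull ℝ X hx hy hs0 hs1 (by ring)
  have hw0 : (s • x + (1 - s) • y) 0 = c := by simp [hx0, hy0]; ring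
  refine orient_anchor_ne_zero hX hw hp hq hpq (by rwa [hw0]) ?_
  have hlin : orient (s • x + (1 - s) • y) p q = s * orient x p q + (1 - s) * orient y p q := by
    simp [orient]; ring
  rw [hlin, hs]
  field_simp
  ring

/-- If `x`, `y`, `q₁`, `q₂`, `q₃` are in weakly convex position in this order (clockwise or
counterclockwise according to the sign of `ε`), then the crossing point of the segments `x q₂` and
`q₁ q₃` lies in the triangle `y q₂ q₃`. -/
theorem inter_nonempty_of_convex_position {I J K : Set Plane} (hI : Convex ℝ I) (hJ : Convex ℝ J)
    (hK : Convex ℝ K) {x y q₁ q₂ q₃ : Plane} {ε : ℝ} (hI1 : q₁ ∈ I) (hI3 : q₃ ∈ I) (hJx : x ∈ J)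
    (hJ2 : q₂ ∈ J) (hKy : y ∈ K) (hK2 : q₂ ∈ K) (hK3 : q₃ ∈ K)
    (hA : 0 < ε * orient q₁ q₂ q₃) (hB : 0 < ε * orient x q₁ q₃) (hP : 0 < ε * orient x q₂ q₃)
    (hQ : 0 < ε * orient x q₁ q₂) (hy13 : 0 < ε * orient y q₁ q₃) (hxy : 0 ≤ ε * orient x y q₂) :
    (I ∩ J ∩ K).Nonempty := by
  set A := ε * orient q₁ q₂ q₃ with hAd
  set B := ε * orient x q₁ q₃ with hBd
  set P := ε * orient x q₂ q₃ with hPd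
  set Q := ε * orient x q₁ q₂ with hQd
  set T := ε * orient y q₁ q₃ with hTd
  set V := ε * orient x y q₂ with hVd
  set u : Plane := (P / (P + Q)) • q₁ + (Q / (P + Q)) • q₃ with hu
  have hs : 0 < P + Q := add_pos hP hQ
  have hu1 : ∀ l, (P + Q) * u l = P * q₁ l + Q * q₃ l := by
    intro l
    simp only [hu, PiLp.add_apply, PiLp.smul_apply, smul_eq_mul]
    field_simp
  have hAB : A + B = P + Q := by
    simp only [hAd, hBd, hPd, hQd, orient]; ring
  have hu2 : ∀ l, (A + B) * u l = A * x l + B * q₂ l := by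
    intro l
    rw [hAB, hu1]
    fin_cases l
    · simp only [hAd, hBd, hPd, hQd, orient, Fin.zero_eta]; ring
    · simp only [hAd, hBd, hPd, hQd, orient, Fin.mk_one]; ring
  -- the barycentric coordinates of `u` in the triangle `y q₂ q₃`
  have e1 : (A + B) * (ε * orient u q₂ q₃) = A * P := by
    simp only [orient] at hPd ⊢
    linear_combination ε * ((q₂ 1 - q₃ 1) * hu2 0 + (q₃ 0 - q₂ 0) * hu2 1) - A * hPd
  have e2 : (P + Q) * (ε * orient y u q₃) = P * T := by
    simp only [orient] at hTd ⊢
    linear_combination ε * ((q₃ 1 - y 1) * hu1 0 + (y 0 - q₃ 0) * hu1 1) - P * hTd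
  have e3 : (A + B) * (ε * orient y q₂ u) = A * V := by
    simp only [orient] at hVd ⊢
    linear_combination ε * ((y 1 - q₂ 1) * hu2 0 + (q₂ 0 - y 0) * hu2 1) - A * hVd
  rw [← hAB] at e2
  have hbary : ∀ l, (A * P + P * T + A * V) * u l
      = A * P * y l + P * T * q₂ l + A * V * q₃ l := by
    intro l
    rw [← e1, ← e2, ← e3]
    fin_cases l
    · simp only [orient, Fin.zero_eta]; ring
    · simp only [orient, Fin.mk_one]; ring
  refine ⟨u, ⟨hI.mem_of_three hI1 hI3 hI3 hP.le hQ.le le_rfl (by linarith) ?_ ?_,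
    hJ.mem_of_three hJx hJ2 hJ2 hA.le hB.le le_rfl (by linarith) ?_ ?_⟩,
    hK.mem_of_three hKy hK2 hK3 (mul_pos hA hP).le (mul_pos hP hy13).le (mul_nonneg hA.le hxy)
      (by have := mul_pos hA hP; have := mul_pos hP hy13; have := mul_nonneg hA.le hxy; linarith)
      ?_ ?_⟩
  · linear_combination hu1 0
  · linear_combination hu1 1
  · linear_combination hu2 0
  · linear_combination hu2 1
  · exact hbary 0
  · exact hbary 1

theorem orient_anchor_eq {x p q : Plane} {c : ℝ} (hx0 : x 0 = c) (hp : c - p 0 ≠ 0)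
    (hq : c - q 0 ≠ 0) : orient x p q = (c - p 0) * (c - q 0) *
      ((p 1 - x 1) / (c - p 0) - (q 1 - x 1) / (c - q 0)) := by
  unfold orient
  rw [hx0]
  field_simp
  ring

/-- A triple with a common point: `x` and `y` are points of a vertical line, `q₁`, `q₂`, `q₃`
points of the curve on one side of it, and `ε * orient` gives the cyclic order
`x, y, q₁, q₂, q₃`. -/
theorem inter_nonempty_of_anchors {X : Set Plane} (hX : IsConvexCurve X) {I J K : Set Plane}
    (hI : Convex ℝ I) (hJ : Convex ℝ J) (hK : Convex ℝ K) {o x y q₁ q₂ q₃ : Plane} {c ε : ℝ}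
    (ho : o ∈ convexHull ℝ X) (hx : x ∈ convexHull ℝ X) (hy : y ∈ convexHull ℝ X)
    (ho0 : o 0 = c) (hx0 : x 0 = c) (hy0 : y 0 = c)
    (hq1 : q₁ ∈ X) (hq2 : q₂ ∈ X) (hq3 : q₃ ∈ X)
    (hs12 : 0 < (c - q₁ 0) * (c - q₂ 0)) (hs23 : 0 < (c - q₂ 0) * (c - q₃ 0))
    (hI1 : q₁ ∈ I) (hI3 : q₃ ∈ I) (hJx : x ∈ J)
    (hJ2 : q₂ ∈ J) (hKy : y ∈ K) (hK2 : q₂ ∈ K) (hK3 : q₃ ∈ K)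
    (hxy : 0 ≤ ε * ((y 1 - x 1) * (c - q₂ 0)))
    (h12 : 0 < ε * orient o q₁ q₂) (h23 : 0 < ε * orient o q₂ q₃) : (I ∩ J ∩ K).Nonempty := by
  have n1 : c - q₁ 0 ≠ 0 := left_ne_zero_of_mul hs12.ne'
  have n2 : c - q₂ 0 ≠ 0 := right_ne_zero_of_mul hs12.ne'
  have n3 : c - q₃ 0 ≠ 0 := right_ne_zero_of_mul hs23.ne'
  have hs13 : 0 < (c - q₁ 0) * (c - q₃ 0) := by
    have h1 : 0 < ((c - q₁ 0) * (c - q₃ 0)) * (c - q₂ 0) ^ 2 := by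
      have := mul_pos hs12 hs23
      linarith
    exact (pos_iff_pos_of_mul_pos h1).2 (by positivity)
  have hself : ∀ q : Plane, orient o q q = 0 := fun q => by unfold orient; ring
  have d12 : q₁ ≠ q₂ := by rintro rfl; simp [hself] at h12
  have d23 : q₂ ≠ q₃ := by rintro rfl; simp [hself] at h23
  have h13 : 0 < ε * orient o q₁ q₃ := by
    rw [orient_anchor_eq ho0 n1 n2] at h12
    rw [orient_anchor_eq ho0 n2 n3] at h23
    rw [orient_anchor_eq ho0 n1 n3]
    have a1 : 0 < ε * ((q₁ 1 - o 1) / (c - q₁ 0) - (q₂ 1 - o 1) / (c - q₂ 0)) :=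
      (pos_iff_pos_of_mul_pos (by linarith)).1 hs12
    have a2 : 0 < ε * ((q₂ 1 - o 1) / (c - q₂ 0) - (q₃ 1 - o 1) / (c - q₃ 0)) :=
      (pos_iff_pos_of_mul_pos (by linarith)).1 hs23
    have := mul_pos hs13 (add_pos a1 a2)
    linarith
  have d13 : q₁ ≠ q₃ := by rintro rfl; simp [hself] at h13
  have tr : ∀ z p q : Plane, z ∈ convexHull ℝ X → z 0 = c → p ∈ X → q ∈ X → p ≠ q →
      0 < (c - p 0) * (c - q 0) → 0 < ε * orient o p q → 0 < ε * orient z p q := by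
    intro z p q hz hz0 hp hq hpq hs h
    have h1 := orient_anchor_mul_pos hX ho hz ho0 hz0 hp hq hpq hs
    have h2 : 0 < (ε * orient z p q) * (orient o p q) ^ 2 := by
      have := mul_pos h h1
      linarith
    have : orient o p q ≠ 0 := fun h' => by simp [h'] at h
    exact (pos_iff_pos_of_mul_pos h2).2 (by positivity)
  have x12 := tr x q₁ q₂ hx hx0 hq1 hq2 d12 hs12 h12
  have x23 := tr x q₂ q₃ hx hx0 hq2 hq3 d23 hs23 h23
  have x13 := tr x q₁ q₃ hx hx0 hq1 hq3 d13 hs13 h13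
  have y13 := tr y q₁ q₃ hy hy0 hq1 hq3 d13 hs13 h13
  have xq : x ≠ q₂ := by
    rintro rfl
    exact n2 (by linarith)
  refine inter_nonempty_of_convex_position hI hJ hK hI1 hI3 hJx hJ2 hKy hK2 hK3 (ε := ε) ?_ x13 x23
    x12 y13 ?_
  · -- otherwise `q₂` lies in the triangle `x q₁ q₃`
    by_contra hle
    refine ((convex_convexHull_diff hX hq2).mem_of_three (u := q₂) (x := x) (y := q₁) (z := q₃)
      ⟨hx, xq⟩ ⟨subset_convexHull ℝ X hq1, d12⟩ ⟨subset_convexHull ℝ X hq3, d23.symm⟩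
      (a := -(ε * orient q₁ q₂ q₃)) (b := ε * orient x q₂ q₃) (c := ε * orient x q₁ q₂)
      (by linarith) x23.le x12.le (by linarith) ?_ ?_).2 rfl
    · unfold orient; ring
    · unfold orient; ring
  · have : orient x y q₂ = (y 1 - x 1) * (c - q₂ 0) := by
      unfold orient; rw [hx0, hy0]; ring
    rwa [this]

/-- The forced triple. Let `A₁`, `A₂`, `B₁`, `B₂` be convex sets with points `a₁`, `a₂`, `b₁`,
`b₂` on a vertical line and in the hull of the curve, the first two below the other two. If each
`Aᵢ` meets each `Bⱼ` in a point of the curve on the same side of the line, and these four points are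
distinct, then three of the four sets have a common point. -/
theorem exists_triple_of_four_cycle {X : Set Plane} (hX : IsConvexCurve X)
    {A₁ A₂ B₁ B₂ : Set Plane} (hA₁ : Convex ℝ A₁) (hA₂ : Convex ℝ A₂) (hB₁ : Convex ℝ B₁)
    (hB₂ : Convex ℝ B₂) {c τ : ℝ} {a₁ a₂ b₁ b₂ p₁₁ p₁₂ p₂₁ p₂₂ : Plane}
    (ha₁ : a₁ ∈ A₁) (ha₂ : a₂ ∈ A₂) (hb₁ : b₁ ∈ B₁) (hb₂ : b₂ ∈ B₂)
    (ha₁X : a₁ ∈ convexHull ℝ X) (ha₂X : a₂ ∈ convexHull ℝ X) (hb₁X : b₁ ∈ convexHull ℝ X)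
    (hb₂X : b₂ ∈ convexHull ℝ X)
    (ha₁c : a₁ 0 = c) (ha₂c : a₂ 0 = c) (hb₁c : b₁ 0 = c) (hb₂c : b₂ 0 = c)
    (h₁₁ : a₁ 1 ≤ b₁ 1) (h₁₂ : a₁ 1 ≤ b₂ 1) (h₂₁ : a₂ 1 ≤ b₁ 1) (h₂₂ : a₂ 1 ≤ b₂ 1)
    (hp₁₁ : p₁₁ ∈ X ∩ A₁ ∩ B₁) (hp₁₂ : p₁₂ ∈ X ∩ A₁ ∩ B₂)
    (hp₂₁ : p₂₁ ∈ X ∩ A₂ ∩ B₁) (hp₂₂ : p₂₂ ∈ X ∩ A₂ ∩ B₂)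
    (hs₁₁ : 0 < τ * (c - p₁₁ 0)) (hs₁₂ : 0 < τ * (c - p₁₂ 0))
    (hs₂₁ : 0 < τ * (c - p₂₁ 0)) (hs₂₂ : 0 < τ * (c - p₂₂ 0))
    (d₁ : p₁₁ ≠ p₁₂) (d₂ : p₁₁ ≠ p₂₁) (d₃ : p₁₁ ≠ p₂₂) (d₄ : p₁₂ ≠ p₂₁) (d₅ : p₁₂ ≠ p₂₂)
    (d₆ : p₂₁ ≠ p₂₂) :
    (A₁ ∩ A₂ ∩ B₁).Nonempty ∨ (A₁ ∩ A₂ ∩ B₂).Nonempty ∨ (A₁ ∩ B₁ ∩ B₂).Nonempty ∨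
      (A₂ ∩ B₁ ∩ B₂).Nonempty := by
  have ss : ∀ {p q : Plane}, 0 < τ * (c - p 0) → 0 < τ * (c - q 0) →
      0 < (c - p 0) * (c - q 0) := by
    intro p q h1 h2
    have h3 : 0 < ((c - p 0) * (c - q 0)) * τ ^ 2 := by
      have := mul_pos h1 h2
      linarith
    have : τ ≠ 0 := left_ne_zero_of_mul h1.ne'
    exact (pos_iff_pos_of_mul_pos h3).2 (by positivity)
  -- the angular order around `a₁`
  set lt : Plane → Plane → Prop := fun p q => 0 < τ * orient a₁ p q with hlt
  have tot : ∀ {p q : Plane}, p ∈ X → q ∈ X → p ≠ q → 0 < τ * (c - p 0) → 0 < τ * (c - q 0) →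
      lt p q ∨ lt q p := by
    intro p q hp hq hpq h1 h2
    have h3 := orient_anchor_ne_zero hX ha₁X hp hq hpq (by rw [ha₁c]; exact ss h1 h2)
    have h4 : orient a₁ q p = -orient a₁ p q := by unfold orient; ring
    have h5 : τ * orient a₁ p q ≠ 0 := mul_ne_zero (left_ne_zero_of_mul h1.ne') h3
    rcases lt_or_gt_of_ne h5 with h6 | h6
    · right
      simp only [hlt, h4]
      linarith
    · left; exact h6
  have up : ∀ {I J K : Set Plane} {x y q₁ q₂ q₃ : Plane}, Convex ℝ I → Convex ℝ J → Convex ℝ K →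
      x ∈ convexHull ℝ X → y ∈ convexHull ℝ X → x 0 = c → y 0 = c → q₁ ∈ X → q₂ ∈ X → q₃ ∈ X →
      0 < τ * (c - q₁ 0) → 0 < τ * (c - q₂ 0) → 0 < τ * (c - q₃ 0) →
      q₁ ∈ I → q₃ ∈ I → x ∈ J → q₂ ∈ J → y ∈ K → q₂ ∈ K → q₃ ∈ K → x 1 ≤ y 1 →
      lt q₁ q₂ → lt q₂ q₃ → (I ∩ J ∩ K).Nonempty := by
    intro I J K x y q₁ q₂ q₃ hI hJ hK hx hy hx0 hy0 h1 h2 h3 s1 s2 s3 i1 i3 jx j2 ky k2 k3 hxy l1 l2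
    refine inter_nonempty_of_anchors hX hI hJ hK (ε := τ) ha₁X hx hy ha₁c hx0 hy0 h1 h2 h3 (ss s1 s2)
      (ss s2 s3) i1 i3 jx j2 ky k2 k3 ?_ l1 l2
    have := mul_nonneg (sub_nonneg.2 hxy) s2.le
    linarith
  have down : ∀ {I J K : Set Plane} {x y q₁ q₂ q₃ : Plane}, Convex ℝ I → Convex ℝ J →
      Convex ℝ K → x ∈ convexHull ℝ X → y ∈ convexHull ℝ X → x 0 = c → y 0 = c → q₁ ∈ X →
      q₂ ∈ X → q₃ ∈ X → 0 < τ * (c - q₁ 0) → 0 < τ * (c - q₂ 0) → 0 < τ * (c - q₃ 0) →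
      q₁ ∈ I → q₃ ∈ I → x ∈ J → q₂ ∈ J → y ∈ K → q₂ ∈ K → q₃ ∈ K → y 1 ≤ x 1 →
      lt q₂ q₁ → lt q₃ q₂ → (I ∩ J ∩ K).Nonempty := by
    intro I J K x y q₁ q₂ q₃ hI hJ hK hx hy hx0 hy0 h1 h2 h3 s1 s2 s3 i1 i3 jx j2 ky k2 k3 hxy l1 l2
    have hneg : ∀ p q : Plane, -τ * orient a₁ q p = τ * orient a₁ p q := fun p q => by
      unfold orient; ring
    refine inter_nonempty_of_anchors hX hI hJ hK (ε := -τ) ha₁X hx hy ha₁c hx0 hy0 h1 h2 h3 (ss s1 s2)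
      (ss s2 s3) i1 i3 jx j2 ky k2 k3 ?_ (by rw [hneg]; exact l1) (by rw [hneg]; exact l2)
    have := mul_nonneg (sub_nonneg.2 hxy) s2.le
    linarith
  obtain ⟨⟨x₁₁, A₁₁⟩, B₁₁⟩ := hp₁₁
  obtain ⟨⟨x₁₂, A₁₂⟩, B₁₂⟩ := hp₁₂
  obtain ⟨⟨x₂₁, A₂₁⟩, B₂₁⟩ := hp₂₁
  obtain ⟨⟨x₂₂, A₂₂⟩, B₂₂⟩ := hp₂₂
  by_contra hcon
  simp only [not_or] at hcon
  obtain ⟨n1, n2, n3, n4⟩ := hcon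
  have c1 : lt p₁₂ p₂₁ → lt p₂₁ p₁₁ → False := fun u v => n1 (up hA₁ hA₂ hB₁ ha₂X hb₁X ha₂c hb₁c
    x₁₂ x₂₁ x₁₁ hs₁₂ hs₂₁ hs₁₁ A₁₂ A₁₁ ha₂ A₂₁ hb₁ B₂₁ B₁₁ h₂₁ u v)
  have c2 : lt p₂₂ p₁₁ → lt p₁₁ p₂₁ → False := fun u v => n1 (by
    rw [Set.inter_comm A₁]
    exact up hA₂ hA₁ hB₁ ha₁X hb₁X ha₁c hb₁c
      x₂₂ x₁₁ x₂₁ hs₂₂ hs₁₁ hs₂₁ A₂₂ A₂₁ ha₁ A₁₁ hb₁ B₁₁ B₂₁ h₁₁ u v)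
  have c3 : lt p₁₁ p₂₂ → lt p₂₂ p₁₂ → False := fun u v => n2 (up hA₁ hA₂ hB₂ ha₂X hb₂X ha₂c hb₂c
    x₁₁ x₂₂ x₁₂ hs₁₁ hs₂₂ hs₁₂ A₁₁ A₁₂ ha₂ A₂₂ hb₂ B₂₂ B₁₂ h₂₂ u v)
  have c4 : lt p₂₁ p₁₂ → lt p₁₂ p₂₂ → False := fun u v => n2 (by
    rw [Set.inter_comm A₁]
    exact up hA₂ hA₁ hB₂ ha₁X hb₂X ha₁c hb₂c
      x₂₁ x₁₂ x₂₂ hs₂₁ hs₁₂ hs₂₂ A₂₁ A₂₂ ha₁ A₁₂ hb₂ B₁₂ B₂₂ h₁₂ u v)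
  have c5 : lt p₂₁ p₁₂ → lt p₂₂ p₂₁ → False := fun u v => n4 (by
    rw [Set.inter_assoc, Set.inter_comm, Set.inter_comm B₁]
    exact down hB₂ hB₁ hA₂ hb₁X ha₂X hb₁c ha₂c
      x₁₂ x₂₁ x₂₂ hs₁₂ hs₂₁ hs₂₂ B₁₂ B₂₂ hb₁ B₂₁ ha₂ A₂₁ A₂₂ h₂₁ u v)
  have c6 : lt p₂₂ p₁₁ → lt p₂₁ p₂₂ → False := fun u v => n4 (by
    rw [Set.inter_assoc, Set.inter_comm]
    exact down hB₁ hB₂ hA₂ hb₂X ha₂X hb₂c ha₂c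
      x₁₁ x₂₂ x₂₁ hs₁₁ hs₂₂ hs₂₁ B₁₁ B₂₁ hb₂ B₂₂ ha₂ A₂₂ A₂₁ h₂₂ u v)
  have c7 : lt p₁₁ p₂₂ → lt p₁₂ p₁₁ → False := fun u v => n3 (by
    rw [Set.inter_assoc, Set.inter_comm, Set.inter_comm B₁]
    exact down hB₂ hB₁ hA₁ hb₁X ha₁X hb₁c ha₁c
      x₂₂ x₁₁ x₁₂ hs₂₂ hs₁₁ hs₁₂ B₂₂ B₁₂ hb₁ B₁₁ ha₁ A₁₁ A₁₂ h₁₁ u v)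
  have c8 : lt p₁₂ p₂₁ → lt p₁₁ p₁₂ → False := fun u v => n3 (by
    rw [Set.inter_assoc, Set.inter_comm]
    exact down hB₁ hB₂ hA₁ hb₂X ha₁X hb₂c ha₁c
      x₂₁ x₁₂ x₁₁ hs₂₁ hs₁₂ hs₁₁ B₂₁ B₁₁ hb₂ B₁₂ ha₁ A₁₂ A₁₁ h₁₂ u v)
  have t₁ := tot x₁₁ x₁₂ d₁ hs₁₁ hs₁₂
  have t₂ := tot x₁₁ x₂₁ d₂ hs₁₁ hs₂₁
  have t₃ := tot x₁₁ x₂₂ d₃ hs₁₁ hs₂₂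
  have t₄ := tot x₁₂ x₂₁ d₄ hs₁₂ hs₂₁
  have t₅ := tot x₁₂ x₂₂ d₅ hs₁₂ hs₂₂
  have t₆ := tot x₂₁ x₂₂ d₆ hs₂₁ hs₂₂
  rcases t₄ with h | h
  · have h1 := t₂.resolve_right (c1 h)
    have h2 := t₁.resolve_left (c8 h)
    exact c2 (t₃.resolve_left fun k => c7 k h2) h1
  · have h1 := t₅.resolve_left (c4 h)
    have h2 := t₆.resolve_right (c5 h)
    exact c6 (t₃.resolve_left fun k => c3 k h1) h2

/-! ### Counting subfamilies with a common point -/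

open Classical in
/-- The `k`-element sets of indices in `U` whose members of the family have a common point
in `Y`. -/
noncomputable def meeting {ι : Type*} (Y : Set Plane) (S : ι → Set Plane) (k : ℕ) (U : Finset ι) :
    Finset (Finset ι) :=
  (U.powersetCard k).filter fun e => ∃ x ∈ Y, ∀ i ∈ e, x ∈ S i

theorem mem_meeting {ι : Type*} {Y : Set Plane} {S : ι → Set Plane} {k : ℕ} {U : Finset ι}
    {e : Finset ι} :
    e ∈ meeting Y S k U ↔ (e ⊆ U ∧ e.card = k) ∧ ∃ x ∈ Y, ∀ i ∈ e, x ∈ S i := by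
  simp [meeting, Finset.mem_powersetCard]

/-- If every `m`-subset of `V` contains at least `t` of the `k`-sets of `F`, then `F` has
proportionally many `k`-sets. -/
theorem mul_choose_le_of_forall_powersetCard {ι : Type*} [DecidableEq ι] {V : Finset ι} {k m t : ℕ}
    (hkm : k ≤ m) (hmV : m ≤ V.card) {F : Finset (Finset ι)}
    (hF : ∀ f ∈ F, f ⊆ V ∧ f.card = k)
    (h : ∀ W ∈ V.powersetCard m, t ≤ (F.filter (· ⊆ W)).card) :
    t * V.card.choose k ≤ F.card * m.choose k := by
  have h1 : V.card.choose m * t ≤ ∑ W ∈ V.powersetCard m, (F.filter (· ⊆ W)).card := by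
    rw [← Finset.card_powersetCard, ← smul_eq_mul]
    exact Finset.card_nsmul_le_sum _ _ _ h
  have h2 : ∑ W ∈ V.powersetCard m, (F.filter (· ⊆ W)).card =
      ∑ f ∈ F, ((V.powersetCard m).filter (f ⊆ ·)).card := by
    simp only [Finset.card_filter]
    exact Finset.sum_comm
  have h3 : ∀ f ∈ F, ((V.powersetCard m).filter (f ⊆ ·)).card ≤
      (V.card - k).choose (m - k) := by
    intro f hf
    obtain ⟨hfV, hfk⟩ := hF f hf
    rw [← hfk, ← Finset.card_sdiff_of_subset hfV, ← Finset.card_powersetCard]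
    refine Finset.card_le_card_of_injOn (fun W => W \ f) ?_ ?_
    · intro W hW
      simp only [Finset.coe_filter, Finset.mem_powersetCard, Set.mem_ofPred_eq] at hW
      simp only [Finset.mem_coe, Finset.mem_powersetCard]
      exact ⟨Finset.sdiff_subset_sdiff hW.1.1 le_rfl, by
        rw [Finset.card_sdiff_of_subset hW.2, hW.1.2]⟩
    · intro W hW W' hW' heq
      simp only [Finset.coe_filter, Finset.mem_powersetCard, Set.mem_ofPred_eq] at hW hW'
      have heq : W \ f = W' \ f := heq
      rw [← Finset.sdiff_union_of_subset hW.2, heq, Finset.sdiff_union_of_subset hW'.2]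
  have h4 : V.card.choose m * t ≤ F.card * (V.card - k).choose (m - k) := by
    rw [h2] at h1
    exact h1.trans (by simpa using Finset.sum_le_card_nsmul _ _ _ h3)
  have h5 := Nat.choose_mul (n := V.card) hkm
  have hpos : 0 < (V.card - k).choose (m - k) := Nat.choose_pos (by omega)
  refine Nat.le_of_mul_le_mul_right ?_ hpos
  calc t * V.card.choose k * (V.card - k).choose (m - k)
      = (V.card.choose m * t) * m.choose k := by rw [mul_assoc, ← h5]; ring
    _ ≤ (F.card * (V.card - k).choose (m - k)) * m.choose k := Nat.mul_le_mul_right _ h4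
    _ = _ := by ring

theorem meeting_filter_subset {ι : Type*} [DecidableEq ι] {Y : Set Plane} {S : ι → Set Plane}
    {k : ℕ} {V W : Finset ι} (hWV : W ⊆ V) :
    (meeting Y S k V).filter (· ⊆ W) = meeting Y S k W := by
  ext e
  simp only [Finset.mem_filter, mem_meeting]
  constructor
  · rintro ⟨⟨⟨_, h2⟩, h3⟩, h4⟩
    exact ⟨⟨h4, h2⟩, h3⟩
  · rintro ⟨⟨h1, h2⟩, h3⟩
    exact ⟨⟨⟨h1.trans hWV, h2⟩, h3⟩, h1⟩

theorem mul_choose_le_card_meeting {ι : Type*} [DecidableEq ι] {Y : Set Plane} {S : ι → Set Plane}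
    {V : Finset ι} {k m t : ℕ} (hkm : k ≤ m) (hmV : m ≤ V.card)
    (h : ∀ W ⊆ V, W.card = m → t ≤ (meeting Y S k W).card) :
    t * V.card.choose k ≤ (meeting Y S k V).card * m.choose k := by
  refine mul_choose_le_of_forall_powersetCard hkm hmV (fun f hf => (mem_meeting.1 hf).1) ?_
  intro W hW
  rw [Finset.mem_powersetCard] at hW
  rw [meeting_filter_subset hW.1]
  exact h W hW.1 hW.2

/-- A graph without independent `p`-sets has at least `|W| - (p - 1)` edges. -/
theorem card_le_card_meeting_add {ι : Type*} [DecidableEq ι] {Y : Set Plane} {S : ι → Set Plane}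
    {p : ℕ} (W : Finset ι)
    (h : ∀ T ⊆ W, T.card = p → (meeting Y S 2 T).Nonempty) :
    W.card + 1 ≤ (meeting Y S 2 W).card + p := by
  induction W using Finset.strongInduction with
  | H W ih =>
    by_cases hW : W.card < p
    · omega
    · obtain ⟨T, hTW, hT⟩ := Finset.exists_subset_card_eq (not_lt.1 hW)
      obtain ⟨e, he⟩ := h T hTW hT
      obtain ⟨⟨heT, he2⟩, hx⟩ := mem_meeting.1 he
      obtain ⟨i, hi⟩ : e.Nonempty := Finset.card_pos.1 (by omega)
      have hiW : i ∈ W := hTW (heT hi)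
      have h1 := ih (W.erase i) (Finset.erase_ssubset hiW) fun T hT =>
        h T (hT.trans (Finset.erase_subset _ _))
      have h2 : insert e (meeting Y S 2 (W.erase i)) ⊆ meeting Y S 2 W := by
        intro f hf
        rcases Finset.mem_insert.1 hf with rfl | hf
        · exact mem_meeting.2 ⟨⟨heT.trans hTW, he2⟩, hx⟩
        · obtain ⟨⟨a, b⟩, c⟩ := mem_meeting.1 hf
          exact mem_meeting.2 ⟨⟨a.trans (Finset.erase_subset _ _), b⟩, c⟩
      have h3 : e ∉ meeting Y S 2 (W.erase i) := fun hf =>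
        Finset.notMem_erase i W ((mem_meeting.1 hf).1.1 hi)
      have h4 := Finset.card_le_card h2
      rw [Finset.card_insert_of_notMem h3] at h4
      rw [Finset.card_erase_of_mem hiW] at h1
      have : 0 < W.card := Finset.card_pos.2 ⟨i, hiW⟩
      omega

/-- The Kővári–Sós–Turán bound for 4-cycles, in a form without square roots: the free parameter
`s` is best chosen near the square root of the number of vertices. -/
theorem two_mul_card_le_of_no_four_cycle {α : Type*} [DecidableEq α] (U : Finset α)
    (R : α → α → Prop) [DecidableRel R] (s : ℕ)
    (h : ∀ i i' j j', i ∈ U → i' ∈ U → j ∈ U → j' ∈ U → i ≠ i' → j ≠ j' → R i j → R i j' →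
      R i' j → R i' j' → False) :
    2 * s * ((U ×ˢ U).filter fun q => R q.1 q.2).card ≤ U.card ^ 2 + U.card * (s * (s + 1)) := by
  set L : α → Finset α := fun j => U.filter (R · j) with hL
  have h1 : ((U ×ˢ U).filter fun q => R q.1 q.2).card = ∑ j ∈ U, (L j).card := by
    simp only [hL, Finset.card_filter]
    rw [Finset.sum_product_right]
  have h2 : ∑ j ∈ U, (L j).offDiag.card ≤ U.card ^ 2 := by
    rw [← Finset.card_biUnion, pow_two, ← Finset.card_product]
    · refine Finset.card_le_card fun q hq => ?_
      obtain ⟨j, hj, hq⟩ := Finset.mem_biUnion.1 hq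
      obtain ⟨ha, hb, -⟩ := Finset.mem_offDiag.1 hq
      exact Finset.mem_product.2 ⟨(Finset.mem_filter.1 ha).1, (Finset.mem_filter.1 hb).1⟩
    · intro j hj j' hj' hne
      refine Finset.disjoint_left.2 fun q hq hq' => ?_
      obtain ⟨ha, hb, hab⟩ := Finset.mem_offDiag.1 hq
      obtain ⟨ha', hb', -⟩ := Finset.mem_offDiag.1 hq'
      simp only [hL, Finset.mem_filter] at ha hb ha' hb'
      exact h q.1 q.2 j j' ha.1 hb.1 hj hj' hab hne ha.2 ha'.2 hb.2 hb'.2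
  have h3 : ∀ j ∈ U, 2 * s * (L j).card ≤ (L j).offDiag.card + s * (s + 1) := by
    intro j _
    rw [Finset.offDiag_card]
    obtain ⟨l, hl⟩ : ∃ l, (L j).card = l := ⟨_, rfl⟩
    rw [hl]
    have hle : l ≤ l * l := Nat.le_mul_self l
    zify [hle]
    -- the product of two consecutive integers is nonnegative
    have key : 0 ≤ ((l : ℤ) - s) * ((l : ℤ) - s - 1) := by
      rcases le_or_gt ((l : ℤ) - s) 0 with h | h
      · exact mul_nonneg_of_nonpos_of_nonpos h (by linarith)
      · exact mul_nonneg h.le (by linarith [Int.add_one_le_iff.2 h])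
    nlinarith
  rw [h1, Finset.mul_sum]
  calc ∑ j ∈ U, 2 * s * (L j).card ≤ ∑ j ∈ U, ((L j).offDiag.card + s * (s + 1)) :=
        Finset.sum_le_sum h3
    _ = ∑ j ∈ U, (L j).offDiag.card + U.card * (s * (s + 1)) := by
        rw [Finset.sum_add_distrib, Finset.sum_const, smul_eq_mul]
    _ ≤ _ := Nat.add_le_add_right h2 _

theorem card_le_two_of_vertical {X : Set Plane} (hX : IsConvexCurve X) {c : ℝ} (F : Finset Plane)
    (hF : ∀ q ∈ F, q ∈ X ∧ q 0 = c) : F.card ≤ 2 := by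
  by_contra hlt
  obtain ⟨x, y, z, hx, hy, hz, hxy, hxz, hyz⟩ := Finset.two_lt_card_iff.1 (not_le.1 hlt)
  refine orient_ne_zero hX (hF x hx).1 (hF y hy).1 (hF z hz).1 hxy hxz hyz ?_
  simp [orient, (hF x hx).2, (hF y hy).2, (hF z hz).2]

/-- The pairs that meet on one side of the line, and lie in no triple with a common point, contain
no 4-cycle with two lower and two upper vertices. -/
theorem two_mul_card_side_le {X : Set Plane} (hX : IsConvexCurve X) {ι : Type*} [LinearOrder ι]
    {S : ι → Set Plane} (hS : ∀ i, Convex ℝ (S i)) (U : Finset ι) (c τ : ℝ) (s : ℕ)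
    (x : ι → Plane) (hx : ∀ i ∈ U, x i ∈ S i ∧ x i ∈ convexHull ℝ X ∧ x i 0 = c)
    (P : Finset ι → Plane) (H : Finset (Finset ι))
    (hH : ∀ e ∈ H, e ⊆ U ∧ e.card = 2 ∧ P e ∈ X ∧ (∀ i ∈ e, P e ∈ S i) ∧ 0 < τ * (c - P e 0) ∧
      ∀ t ∈ meeting Set.univ S 3 U, ¬ e ⊆ t)
    (hinj : ∀ e ∈ H, ∀ e' ∈ H, e ≠ e' → P e ≠ P e') :
    2 * s * H.card ≤ U.card ^ 2 + U.card * (s * (s + 1)) := by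
  classical
  set Tr := meeting Set.univ S 3 U with hTr
  -- indices ordered by the heights of the chosen points, ties broken by the index
  set R : ι → ι → Prop := fun i j =>
    (x i 1 < x j 1 ∨ x i 1 = x j 1 ∧ i < j) ∧ {i, j} ∈ H with hR
  have hRle : ∀ {i j}, R i j → x i 1 ≤ x j 1 := by
    rintro i j ⟨h | h, -⟩
    exacts [h.le, h.1.le]
  have hRne : ∀ {i j}, R i j → i ≠ j := by
    rintro i j ⟨h | h, -⟩ rfl
    exacts [lt_irrefl _ h, lt_irrefl _ h.2]
  have hcard : H.card ≤ ((U ×ˢ U).filter fun q => R q.1 q.2).card := by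
    refine Finset.card_le_card_of_surjOn (fun q => {q.1, q.2}) ?_
    intro e he
    obtain ⟨heU, he2, -⟩ := hH e he
    obtain ⟨i, j, hij, rfl⟩ := Finset.card_eq_two.1 he2
    have hiU : i ∈ U := heU (by simp)
    have hjU : j ∈ U := heU (by simp)
    have htot : (x i 1 < x j 1 ∨ x i 1 = x j 1 ∧ i < j) ∨
        (x j 1 < x i 1 ∨ x j 1 = x i 1 ∧ j < i) := by
      rcases lt_trichotomy (x i 1) (x j 1) with h | h | h
      · exact Or.inl (Or.inl h)
      · rcases lt_or_gt_of_ne hij with h' | h'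
        · exact Or.inl (Or.inr ⟨h, h'⟩)
        · exact Or.inr (Or.inr ⟨h.symm, h'⟩)
      · exact Or.inr (Or.inl h)
    rcases htot with h | h
    · exact ⟨(i, j), by simpa [hiU, hjU, hR] using ⟨h, he⟩, rfl⟩
    · exact ⟨(j, i), by simpa [hiU, hjU, hR] using ⟨h, by rwa [Finset.pair_comm]⟩,
        Finset.pair_comm _ _⟩
  refine (Nat.mul_le_mul_left _ hcard).trans (two_mul_card_le_of_no_four_cycle U R s ?_)
  intro i i' j j' hi hi' hj hj' hii hjj r₁₁ r₁₂ r₂₁ r₂₂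
  have hp : ∀ {a b}, R a b → P {a, b} ∈ X ∩ S a ∩ S b := by
    intro a b hab
    have := hH _ hab.2
    exact ⟨⟨this.2.2.1, this.2.2.2.1 a (by simp)⟩, this.2.2.2.1 b (by simp)⟩
  have hs : ∀ {a b}, R a b → 0 < τ * (c - P {a, b} 0) := fun hab =>
    (hH _ hab.2).2.2.2.2.1
  have hd : ∀ {a b a' b'}, R a b → R a' b' → ({a, b} : Finset ι) ≠ {a', b'} →
      P {a, b} ≠ P {a', b'} := fun h h' hne => hinj _ h.2 _ h'.2 hne
  have n₁₁ := hRne r₁₁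
  have n₁₂ := hRne r₁₂
  have n₂₁ := hRne r₂₁
  have n₂₂ := hRne r₂₂
  have hpair : ∀ {a b a' b' : ι}, (a ≠ a' ∧ a ≠ b') ∨ (b ≠ a' ∧ b ≠ b') →
      ({a, b} : Finset ι) ≠ {a', b'} := by
    intro a b a' b' h heq
    have ha : a ∈ ({a', b'} : Finset ι) := heq ▸ (by simp)
    have hb : b ∈ ({a', b'} : Finset ι) := heq ▸ (by simp)
    simp only [Finset.mem_insert, Finset.mem_singleton] at ha hb
    rcases h with ⟨h1, h2⟩ | ⟨h1, h2⟩
    · exact ha.elim h1 h2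
    · exact hb.elim h1 h2
  have htri : ∀ {a b d : ι}, a ∈ U → b ∈ U → d ∈ U → a ≠ b → a ≠ d → b ≠ d →
      (S a ∩ S b ∩ S d).Nonempty → ({a, b, d} : Finset ι) ∈ Tr := by
    rintro a b d ha hb hd hab had hbd ⟨z, ⟨hza, hzb⟩, hzd⟩
    refine mem_meeting.2 ⟨⟨?_, Finset.card_eq_three.2 ⟨a, b, d, hab, had, hbd, rfl⟩⟩,
      z, trivial, ?_⟩
    · intro y hy
      simp only [Finset.mem_insert, Finset.mem_singleton] at hy
      rcases hy with rfl | rfl | rfl <;> assumption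
    · intro y hy
      simp only [Finset.mem_insert, Finset.mem_singleton] at hy
      rcases hy with rfl | rfl | rfl <;> assumption
  have hno : ∀ {a b : ι} {t : Finset ι}, R a b → t ∈ Tr → a ∈ t → b ∈ t → False := by
    intro a b t hab ht ha hb
    refine (hH _ hab.2).2.2.2.2.2 t ht ?_
    intro y hy
    simp only [Finset.mem_insert, Finset.mem_singleton] at hy
    rcases hy with rfl | rfl <;> assumption
  rcases exists_triple_of_four_cycle hX (hS i) (hS i') (hS j) (hS j') (hx i hi).1 (hx i' hi').1
    (hx j hj).1 (hx j' hj').1 (hx i hi).2.1 (hx i' hi').2.1 (hx j hj).2.1 (hx j' hj').2.1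
    (hx i hi).2.2 (hx i' hi').2.2 (hx j hj).2.2 (hx j' hj').2.2 (hRle r₁₁) (hRle r₁₂) (hRle r₂₁)
    (hRle r₂₂) (hp r₁₁) (hp r₁₂) (hp r₂₁) (hp r₂₂) (hs r₁₁) (hs r₁₂) (hs r₂₁) (hs r₂₂)
    (hd r₁₁ r₁₂ (hpair (Or.inr ⟨n₁₁.symm, hjj⟩))) (hd r₁₁ r₂₁ (hpair (Or.inl ⟨hii, n₁₁⟩)))
    (hd r₁₁ r₂₂ (hpair (Or.inl ⟨hii, n₁₂⟩))) (hd r₁₂ r₂₁ (hpair (Or.inl ⟨hii, n₁₁⟩)))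
    (hd r₁₂ r₂₂ (hpair (Or.inl ⟨hii, n₁₂⟩))) (hd r₂₁ r₂₂ (hpair (Or.inr ⟨n₂₁.symm, hjj⟩)))
    with h | h | h | h
  · exact hno r₁₁ (htri hi hi' hj hii n₁₁ n₂₁ h) (by simp) (by simp)
  · exact hno r₁₂ (htri hi hi' hj' hii n₁₂ n₂₂ h) (by simp) (by simp)
  · exact hno r₁₁ (htri hi hj hj' n₁₁ n₁₂ hjj h) (by simp) (by simp)
  · exact hno r₂₁ (htri hi' hj hj' n₂₁ n₂₂ hjj h) (by simp) (by simp)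

/-- The crossing inequality. If all members of the family meet a vertical line within the hull of
their points on the curve, then the number of pairs that meet on the curve is at most of order
`|U| ^ (3 / 2)`, up to three pairs for each triple with a common point. -/
theorem card_meeting_two_le {X : Set Plane} (hX : IsConvexCurve X) {ι : Type*} [LinearOrder ι]
    {S : ι → Set Plane} (hS : ∀ i, Convex ℝ (S i)) (U : Finset ι) (c : ℝ)
    (hU : ∀ i ∈ U, ∃ x ∈ convexHull ℝ (S i ∩ X), x 0 = c) (s : ℕ) :
    s * (meeting X S 2 U).card ≤
      s * (3 * (meeting Set.univ S 3 U).card + 2) + U.card ^ 2 + U.card * (s * (s + 1)) := by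
  classical
  have hU' : ∀ i, ∃ x : Plane, i ∈ U → x ∈ S i ∧ x ∈ convexHull ℝ X ∧ x 0 = c := by
    intro i
    by_cases hi : i ∈ U
    · obtain ⟨x, hx, hxc⟩ := hU i hi
      exact ⟨x, fun _ => ⟨convexHull_min Set.inter_subset_left (hS i) hx,
        convexHull_mono Set.inter_subset_right hx, hxc⟩⟩
    · exact ⟨0, fun h => absurd h hi⟩
  choose x hx using hU'
  have hP' : ∀ e, ∃ q : Plane, e ∈ meeting X S 2 U → q ∈ X ∧ ∀ i ∈ e, q ∈ S i := by
    intro e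
    by_cases he : e ∈ meeting X S 2 U
    · obtain ⟨q, hq, hq'⟩ := (mem_meeting.1 he).2
      exact ⟨q, fun _ => ⟨hq, hq'⟩⟩
    · exact ⟨0, fun h => absurd h he⟩
  choose P hP using hP'
  set Tr := meeting Set.univ S 3 U with hTr
  set G := (meeting X S 2 U).filter (fun e => ∀ t ∈ Tr, ¬ e ⊆ t) with hG
  have hGm : ∀ {e}, e ∈ G → e ∈ meeting X S 2 U := fun he => (Finset.mem_filter.1 he).1
  have hbad : ((meeting X S 2 U).filter (fun e => ¬ ∀ t ∈ Tr, ¬ e ⊆ t)).card ≤ 3 * Tr.card := by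
    have hsub : (meeting X S 2 U).filter (fun e => ¬ ∀ t ∈ Tr, ¬ e ⊆ t) ⊆
        Tr.biUnion fun t => t.powersetCard 2 := by
      intro e he
      obtain ⟨he, h⟩ := Finset.mem_filter.1 he
      push Not at h
      obtain ⟨t, ht, het⟩ := h
      exact Finset.mem_biUnion.2 ⟨t, ht, Finset.mem_powersetCard.2
        ⟨het, (mem_meeting.1 he).1.2⟩⟩
    refine (Finset.card_le_card hsub).trans ?_
    rw [mul_comm]
    refine Finset.card_biUnion_le_card_mul _ _ _ fun t ht => ?_
    rw [Finset.card_powersetCard, (mem_meeting.1 ht).1.2]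
    decide
  have hsplit := Finset.card_filter_add_card_filter_not (s := meeting X S 2 U)
    (fun e => ∀ t ∈ Tr, ¬ e ⊆ t)
  have hinj : ∀ {e e'}, e ∈ G → e' ∈ G → e ≠ e' → P e ≠ P e' := by
    intro e e' he he' hne heq
    obtain ⟨⟨heU, he2⟩, -⟩ := mem_meeting.1 (hGm he)
    obtain ⟨⟨heU', he2'⟩, -⟩ := mem_meeting.1 (hGm he')
    obtain ⟨i, hi', hi⟩ : ∃ i ∈ e', i ∉ e := by
      by_contra! hcon
      exact hne (Finset.eq_of_subset_of_card_le (fun i hi => hcon i hi) (by omega)).symm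
    refine (Finset.mem_filter.1 he).2 (insert i e) ?_ (Finset.subset_insert _ _)
    refine mem_meeting.2 ⟨⟨Finset.insert_subset (heU' hi') heU, by
      rw [Finset.card_insert_of_notMem hi, he2]⟩, P e, trivial, ?_⟩
    intro j hj
    rcases Finset.mem_insert.1 hj with rfl | hj
    · rw [heq]; exact (hP e' (hGm he')).2 j hi'
    · exact (hP e (hGm he)).2 j hj
  have hzero : (G.filter fun e => c - P e 0 = 0).card ≤ 2 := by
    rw [← Finset.card_image_of_injOn (f := P)]
    · refine card_le_two_of_vertical hX (c := c) _ fun q hq => ?_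
      obtain ⟨e, he, rfl⟩ := Finset.mem_image.1 hq
      obtain ⟨he, h0⟩ := Finset.mem_filter.1 he
      exact ⟨(hP e (hGm he)).1, by linarith⟩
    · intro e he e' he' heq
      by_contra hne
      exact hinj (Finset.mem_filter.1 he).1 (Finset.mem_filter.1 he').1 hne heq
  have hside : ∀ τ : ℝ, 2 * s * (G.filter fun e => 0 < τ * (c - P e 0)).card ≤
      U.card ^ 2 + U.card * (s * (s + 1)) := by
    intro τ
    refine two_mul_card_side_le hX hS U c τ s x (fun i hi => hx i hi) P _ ?_ ?_
    · intro e he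
      obtain ⟨he, h0⟩ := Finset.mem_filter.1 he
      obtain ⟨⟨heU, he2⟩, -⟩ := mem_meeting.1 (hGm he)
      exact ⟨heU, he2, (hP e (hGm he)).1, (hP e (hGm he)).2, h0, (Finset.mem_filter.1 he).2⟩
    · intro e he e' he' hne
      exact hinj (Finset.mem_filter.1 he).1 (Finset.mem_filter.1 he').1 hne
  have hGcard : G.card ≤ 2 + (G.filter fun e => 0 < (1 : ℝ) * (c - P e 0)).card +
      (G.filter fun e => 0 < (-1 : ℝ) * (c - P e 0)).card := by
    have hsub : G ⊆ (G.filter fun e => c - P e 0 = 0) ∪ (G.filter fun e => 0 < (1 : ℝ) * (c - P e 0))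
        ∪ (G.filter fun e => 0 < (-1 : ℝ) * (c - P e 0)) := by
      intro e he
      simp only [Finset.mem_union, Finset.mem_filter]
      rcases lt_trichotomy (c - P e 0) 0 with h | h | h
      · right; exact ⟨he, by linarith⟩
      · left; left; exact ⟨he, h⟩
      · left; right; exact ⟨he, by linarith⟩
    calc G.card ≤ _ := Finset.card_le_card hsub
      _ ≤ _ := Finset.card_union_le _ _
      _ ≤ _ := Nat.add_le_add_right (Finset.card_union_le _ _) _
      _ ≤ _ := by gcongr
  have h1 := hside 1
  have h2 := hside (-1)
  rw [← hsplit]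
  have h3 : s * G.card ≤ s * (2 + (G.filter fun e => 0 < (1 : ℝ) * (c - P e 0)).card +
      (G.filter fun e => 0 < (-1 : ℝ) * (c - P e 0)).card) := Nat.mul_le_mul_left _ hGcard
  have h4 := Nat.mul_le_mul_left s hbad
  nlinarith

/-- A vertical line that meets many hulls: it passes through the rightmost meeting point of a
suitable member. -/
theorem exists_vertical_line {X : Set Plane} {ι : Type*} [DecidableEq ι] {S : ι → Set Plane}
    (V : Finset ι) :
    ∃ (c : ℝ) (V' : Finset ι), V' ⊆ V ∧ (∀ i ∈ V', ∃ x ∈ convexHull ℝ (S i ∩ X), x 0 = c) ∧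
      (meeting X S 2 V).card ≤ V.card * V'.card := by
  classical
  have hP' : ∀ e, ∃ q : Plane, e ∈ meeting X S 2 V → q ∈ X ∧ ∀ i ∈ e, q ∈ S i := by
    intro e
    by_cases he : e ∈ meeting X S 2 V
    · obtain ⟨q, hq, hq'⟩ := (mem_meeting.1 he).2
      exact ⟨q, fun _ => ⟨hq, hq'⟩⟩
    · exact ⟨0, fun h => absurd h he⟩
  choose P hP using hP'
  have hr' : ∀ i, ∃ r : ℝ, (∀ e ∈ meeting X S 2 V, i ∈ e → P e 0 ≤ r) ∧
      ((∃ e ∈ meeting X S 2 V, i ∈ e) → ∃ e ∈ meeting X S 2 V, i ∈ e ∧ P e 0 = r) := by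
    intro i
    by_cases h : ((meeting X S 2 V).filter (i ∈ ·)).Nonempty
    · obtain ⟨e, he, hmax⟩ := Finset.exists_max_image _ (fun e => P e 0) h
      obtain ⟨he, hie⟩ := Finset.mem_filter.1 he
      exact ⟨P e 0, fun f hf hif => hmax f (Finset.mem_filter.2 ⟨hf, hif⟩),
        fun _ => ⟨e, he, hie, rfl⟩⟩
    · rw [Finset.not_nonempty_iff_eq_empty, Finset.filter_eq_empty_iff] at h
      exact ⟨0, fun e he hie => absurd hie (h he), fun ⟨e, he, hie⟩ => absurd hie (h he)⟩
  choose r hr1 hr2 using hr'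
  rcases V.eq_empty_or_nonempty with rfl | hV
  · refine ⟨0, ∅, le_rfl, by simp, ?_⟩
    simp [meeting]
  -- every pair is charged to the member whose rightmost point is further to the left
  have hm' : ∀ e, ∃ i, e ∈ meeting X S 2 V → i ∈ e ∧ ∀ j ∈ e, r i ≤ r j := by
    intro e
    by_cases he : e ∈ meeting X S 2 V
    · have hne : e.Nonempty := Finset.card_pos.1 (by rw [(mem_meeting.1 he).1.2]; norm_num)
      obtain ⟨i, hi, hmin⟩ := Finset.exists_min_image e r hne
      exact ⟨i, fun _ => ⟨hi, hmin⟩⟩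
    · exact ⟨hV.choose, fun h => absurd h he⟩
  choose m hm using hm'
  have hmaps : ∀ e ∈ meeting X S 2 V, m e ∈ V := fun e he =>
    (mem_meeting.1 he).1.1 (hm e he).1
  obtain ⟨i, hiV, hi⟩ := Finset.exists_max_image V
    (fun i => ((meeting X S 2 V).filter (m · = i)).card) hV
  refine ⟨r i, V.filter fun j => ∃ x ∈ convexHull ℝ (S j ∩ X), x 0 = r i, Finset.filter_subset _ _,
    fun j hj => (Finset.mem_filter.1 hj).2, ?_⟩
  have h1 : (meeting X S 2 V).card ≤ V.card * ((meeting X S 2 V).filter (m · = i)).card := by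
    rw [Finset.card_eq_sum_card_fiberwise hmaps]
    exact Finset.sum_le_card_nsmul _ _ _ hi
  refine h1.trans (Nat.mul_le_mul_left _ ?_)
  have hsurj : Set.SurjOn (fun j => ({i, j} : Finset ι))
      ((V.filter fun j => ∃ x ∈ convexHull ℝ (S j ∩ X), x 0 = r i : Finset ι) : Set ι)
      ((meeting X S 2 V).filter (m · = i) : Finset (Finset ι)) := by
    intro e he
    obtain ⟨he, hmi⟩ := Finset.mem_filter.1 he
    obtain ⟨hie, hmin⟩ := hm e he
    rw [hmi] at hie hmin
    obtain ⟨⟨heV, he2⟩, -⟩ := mem_meeting.1 he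
    obtain ⟨j, hj⟩ : ∃ j, e = {i, j} := by
      obtain ⟨a, b, hab, rfl⟩ := Finset.card_eq_two.1 he2
      simp only [Finset.mem_insert, Finset.mem_singleton] at hie
      rcases hie with rfl | rfl
      · exact ⟨b, rfl⟩
      · exact ⟨a, Finset.pair_comm _ _⟩
    have hje : j ∈ e := by rw [hj]; simp
    refine ⟨j, ?_, hj.symm⟩
    rw [Finset.coe_filter]
    refine ⟨heV hje, ?_⟩
    obtain ⟨f, hf, hjf, hfr⟩ := hr2 j ⟨e, he, hje⟩
    have ha : P e ∈ convexHull ℝ (S j ∩ X) :=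
      subset_convexHull ℝ _ ⟨(hP e he).2 j hje, (hP e he).1⟩
    have hb : P f ∈ convexHull ℝ (S j ∩ X) :=
      subset_convexHull ℝ _ ⟨(hP f hf).2 j hjf, (hP f hf).1⟩
    have hcont : Continuous fun z : Plane => z 0 := by fun_prop
    have := (convex_convexHull ℝ (S j ∩ X)).isPreconnected.intermediate_value ha hb
      hcont.continuousOn (show r i ∈ Set.Icc (P e 0) (P f 0) from
        ⟨hr1 i e he hie, by rw [hfr]; exact hmin j hje⟩)
    obtain ⟨z, hz, hzr⟩ := this
    exact ⟨z, hz, hzr⟩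
  exact Finset.card_le_card_of_surjOn _ hsurj

/-! ### A fractional Helly theorem -/

theorem exists_min_norm {K : Set Plane} (hK : IsCompact K) (hc : Convex ℝ K) (hne : K.Nonempty) :
    ∃ m ∈ K, (∀ z ∈ K, ‖m‖ ≤ ‖z‖) ∧ ∀ y ∈ K, (∀ z ∈ K, ‖y‖ ≤ ‖z‖) → y = m := by
  obtain ⟨m, hm, hmin⟩ := hK.exists_isMinOn hne continuous_norm.continuousOn
  refine ⟨m, hm, fun z hz => hmin hz, fun y hy hymin => ?_⟩
  by_contra hne
  have heq : ‖y‖ = ‖m‖ := le_antisymm (hymin m hm) (hmin hy)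
  have hlt := (norm_midpoint_lt_iff heq).2 hne
  have hmid : (1 / 2 : ℝ) • (y + m) ∈ K := by
    rw [smul_add]
    exact hc hy hm (by norm_num) (by norm_num) (by norm_num)
  exact absurd (hymin _ hmid) (not_le.2 hlt)

/-- Fractional Helly theorem in the plane. The point of smallest norm common to three convex bodies
is, by Helly's theorem, already the point of smallest norm common to two of them, so some pair
serves many triples. -/
theorem exists_deep_point_of_triples {ι : Type*} [DecidableEq ι] {S : ι → Set Plane}
    (hc : ∀ i, Convex ℝ (S i)) (hK : ∀ i, IsCompact (S i)) (V : Finset ι)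
    [∀ z, DecidablePred fun i => z ∈ S i]
    (hT : 0 < (meeting Set.univ S 3 V).card) :
    ∃ z, (meeting Set.univ S 3 V).card + 2 * V.card.choose 2 ≤
      V.card.choose 2 * (V.filter fun i => z ∈ S i).card := by
  classical
  have hm' : ∀ e : Finset ι, ∃ m : Plane, e.Nonempty → (⋂ i ∈ e, S i).Nonempty →
      m ∈ ⋂ i ∈ e, S i ∧ ∀ y ∈ ⋂ i ∈ e, S i, (∀ z ∈ ⋂ i ∈ e, S i, ‖y‖ ≤ ‖z‖) → y = m := by
    intro e
    by_cases h : e.Nonempty ∧ (⋂ i ∈ e, S i).Nonempty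
    · obtain ⟨⟨i, hi⟩, h⟩ := h
      have hcomp : IsCompact (⋂ i ∈ e, S i) :=
        (hK i).of_isClosed_subset (isClosed_biInter fun i _ => (hK i).isClosed)
          (Set.biInter_subset_of_mem hi)
      obtain ⟨m, hm, -, huniq⟩ := exists_min_norm hcomp (convex_iInter₂ fun i _ => hc i) h
      exact ⟨m, fun _ _ => ⟨hm, huniq⟩⟩
    · exact ⟨0, fun h1 h2 => absurd ⟨h1, h2⟩ h⟩
  choose m hm using hm'
  have hpair : ∀ t ∈ meeting Set.univ S 3 V, ∃ e ∈ t.powersetCard 2, ∀ i ∈ t, m e ∈ S i := by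
    intro t ht
    obtain ⟨⟨htV, ht3⟩, x, -, hx⟩ := mem_meeting.1 ht
    have htne : t.Nonempty := Finset.card_pos.1 (by omega)
    have htx : (⋂ i ∈ t, S i).Nonempty := ⟨x, by simpa using hx⟩
    have hcomp : IsCompact (⋂ i ∈ t, S i) :=
      (hK htne.choose).of_isClosed_subset (isClosed_biInter fun i _ => (hK i).isClosed)
        (Set.biInter_subset_of_mem htne.choose_spec)
    obtain ⟨y, hy, hymin, -⟩ := exists_min_norm hcomp (convex_iInter₂ fun i _ => hc i) htx
    by_contra! hcon
    -- Helly's theorem for the three bodies and the open ball that reaches up to `y`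
    set F : Option ι → Set Plane := fun o => o.elim (Metric.ball 0 ‖y‖) S with hF
    have hall : (⋂ o ∈ insert none (t.map Function.Embedding.some), F o).Nonempty := by
      refine Convex.helly_theorem' (𝕜 := ℝ) ?_ ?_
      · intro o _
        cases o with
        | none => exact convex_ball _ _
        | some i => exact hc i
      · intro I hI hI3
        rw [finrank_euclideanSpace_fin] at hI3
        set e : Finset ι := I.eraseNone with he
        have het : e ⊆ t := by
          intro i hi
          have := hI (Finset.mem_eraseNone.1 hi)
          simpa using this
        by_cases hnone : none ∈ I
        · have hcard : e.card ≤ 2 := by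
            rw [he, Finset.card_eraseNone_of_mem hnone]
            omega
          obtain ⟨e', hee', he't, he'2⟩ := Finset.exists_subsuperset_card_eq het hcard
            (by omega : 2 ≤ t.card)
          obtain ⟨i, hit, hi⟩ := hcon e' (Finset.mem_powersetCard.2 ⟨he't, he'2⟩)
          have hye' : y ∈ ⋂ i ∈ e', S i := by
            simp only [Set.mem_iInter] at hy ⊢
            exact fun i hi => hy i (he't hi)
          have hnm : ∃ z ∈ ⋂ i ∈ e', S i, ‖z‖ < ‖y‖ := by
            by_contra! hge
            have hyeq := (hm e' (Finset.card_pos.1 (by omega)) ⟨y, hye'⟩).2 y hye' hge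
            rw [← hyeq] at hi
            simp only [Set.mem_iInter] at hy
            exact hi (hy i hit)
          obtain ⟨z, hz, hzy⟩ := hnm
          refine ⟨z, ?_⟩
          simp only [Set.mem_iInter] at hz ⊢
          intro o ho
          cases o with
          | none => simpa [hF] using hzy
          | some i => exact hz i (hee' (Finset.mem_eraseNone.2 ho))
        · refine ⟨x, ?_⟩
          simp only [Set.mem_iInter]
          intro o ho
          cases o with
          | none => exact absurd ho hnone
          | some i => exact hx i (het (Finset.mem_eraseNone.2 ho))
    obtain ⟨z, hz⟩ := hall
    simp only [Set.mem_iInter] at hz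
    have h1 : z ∈ Metric.ball (0 : Plane) ‖y‖ := hz none (by simp)
    have h2 : z ∈ ⋂ i ∈ t, S i := by
      simp only [Set.mem_iInter]
      exact fun i hi => hz (some i) (by simp [hi])
    rw [mem_ball_zero_iff] at h1
    exact absurd (hymin z h2) (not_le.2 h1)
  have hg' : ∀ t, ∃ e, t ∈ meeting Set.univ S 3 V → e ∈ t.powersetCard 2 ∧ ∀ i ∈ t, m e ∈ S i := by
    intro t
    by_cases ht : t ∈ meeting Set.univ S 3 V
    · obtain ⟨e, he⟩ := hpair t ht
      exact ⟨e, fun _ => he⟩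
    · exact ⟨∅, fun h => absurd h ht⟩
  choose g hg using hg'
  have hmaps : ∀ t ∈ meeting Set.univ S 3 V, g t ∈ V.powersetCard 2 := by
    intro t ht
    obtain ⟨h1, h2⟩ := Finset.mem_powersetCard.1 (hg t ht).1
    exact Finset.mem_powersetCard.2 ⟨h1.trans (mem_meeting.1 ht).1.1, h2⟩
  obtain ⟨t₀, ht₀⟩ := Finset.card_pos.1 hT
  obtain ⟨e, heV, he⟩ := Finset.exists_max_image (V.powersetCard 2)
    (fun e => ((meeting Set.univ S 3 V).filter (g · = e)).card) ⟨_, hmaps t₀ ht₀⟩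
  have h1 : (meeting Set.univ S 3 V).card ≤
      V.card.choose 2 * ((meeting Set.univ S 3 V).filter (g · = e)).card := by
    rw [← Finset.card_powersetCard, Finset.card_eq_sum_card_fiberwise hmaps]
    exact Finset.sum_le_card_nsmul _ _ _ he
  obtain ⟨t₁, ht₁⟩ : ((meeting Set.univ S 3 V).filter (g · = e)).Nonempty := by
    rw [← Finset.card_pos]
    by_contra h0
    rw [Nat.eq_zero_of_not_pos h0, mul_zero] at h1
    omega
  obtain ⟨heV', he2⟩ := Finset.mem_powersetCard.1 heV
  have hmem : ∀ t ∈ (meeting Set.univ S 3 V).filter (g · = e), t ⊆ V ∧ t.card = 3 ∧ e ⊆ t ∧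
      ∀ i ∈ t, m e ∈ S i := by
    intro t ht
    obtain ⟨ht', hte⟩ := Finset.mem_filter.1 ht
    rw [← hte]
    exact ⟨(mem_meeting.1 ht').1.1, (mem_meeting.1 ht').1.2,
      (Finset.mem_powersetCard.1 (hg t ht').1).1, (hg t ht').2⟩
  refine ⟨m e, ?_⟩
  have hesub : e ⊆ V.filter fun i => m e ∈ S i := fun i hi =>
    Finset.mem_filter.2 ⟨heV' hi, (hmem t₁ ht₁).2.2.2 i ((hmem t₁ ht₁).2.2.1 hi)⟩
  have h2 : ((meeting Set.univ S 3 V).filter (g · = e)).card ≤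
      ((V.filter fun i => m e ∈ S i) \ e).card := by
    refine Finset.card_le_card_of_surjOn (fun i => insert i e) ?_
    intro t ht
    obtain ⟨htV, ht3, het, hmt⟩ := hmem t ht
    have : (t \ e).card = 1 := by rw [Finset.card_sdiff_of_subset het]; omega
    obtain ⟨i, hi⟩ := Finset.card_eq_one.1 this
    have hi' : i ∈ t \ e := by rw [hi]; simp
    obtain ⟨hit, hie⟩ := Finset.mem_sdiff.1 hi'
    refine ⟨i, ?_, ?_⟩
    · simp only [Finset.coe_sdiff, Finset.coe_filter]
      exact ⟨⟨htV hit, hmt i hit⟩, hie⟩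
    · show insert i e = t
      rw [Finset.insert_eq, ← hi]
      exact Finset.sdiff_union_of_subset het
  rw [Finset.card_sdiff_of_subset hesub, he2] at h2
  have h3 : 2 ≤ (V.filter fun i => m e ∈ S i).card := by
    rw [← he2]; exact Finset.card_le_card hesub
  have h4 := Nat.mul_le_mul_left (V.card.choose 2) h2
  calc _ ≤ V.card.choose 2 * ((V.filter fun i => m e ∈ S i).card - 2) + 2 * V.card.choose 2 :=
        Nat.add_le_add_right (h1.trans h4) _
    _ = V.card.choose 2 * ((V.filter fun i => m e ∈ S i).card - 2 + 2) := by ring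
    _ = _ := by rw [Nat.sub_add_cancel h3]

/-- If every `N` members among `V` contain at least `t` triples with a common point, then some point
is common to a positive fraction of `V`. -/
theorem exists_deep_point_of_forall_subset {ι : Type*} [DecidableEq ι] {S : ι → Set Plane}
    (hc : ∀ i, Convex ℝ (S i)) (hK : ∀ i, IsCompact (S i)) (V : Finset ι)
    [∀ z, DecidablePred fun i => z ∈ S i] {N t : ℕ} (hN : 3 ≤ N) (hNV : N ≤ V.card) (ht : 0 < t)
    (h : ∀ U ⊆ V, U.card = N → t ≤ (meeting Set.univ S 3 U).card) :
    ∃ z, t * V.card ≤ 3 * N.choose 3 * (V.filter fun i => z ∈ S i).card := by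
  have h1 := mul_choose_le_card_meeting hN hNV h
  have hpos2 : 0 < V.card.choose 2 := Nat.choose_pos (by omega)
  have hpos3 : 0 < V.card.choose 3 := Nat.choose_pos (by omega)
  have hT : 0 < (meeting Set.univ S 3 V).card := by
    by_contra h0
    rw [Nat.eq_zero_of_not_pos h0, zero_mul] at h1
    exact absurd h1 (not_le.2 (Nat.mul_pos ht hpos3))
  obtain ⟨z, hz⟩ := exists_deep_point_of_triples hc hK V hT
  refine ⟨z, ?_⟩
  have ht3 : t ≤ N.choose 3 := by
    obtain ⟨U, hUV, hU⟩ := Finset.exists_subset_card_eq hNV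
    refine (h U hUV hU).trans ?_
    rw [← hU, ← Finset.card_powersetCard]
    exact Finset.card_le_card fun e he => Finset.mem_powersetCard.2 (mem_meeting.1 he).1
  have h3 := Nat.choose_succ_right_eq V.card 2
  obtain ⟨n, hn⟩ : ∃ n, V.card = n + 2 := ⟨V.card - 2, by omega⟩
  set d := (V.filter fun i => z ∈ S i).card
  set T := (meeting Set.univ S 3 V).card
  rw [hn] at h1 hz h3 hpos2 ⊢
  simp only [Nat.add_sub_cancel] at h3
  refine Nat.le_of_mul_le_mul_left ?_ hpos2
  have h4 : t * ((n + 2).choose 3 * 3) ≤ 3 * (T * N.choose 3) := by linarith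
  rw [h3] at h4
  have h5 := Nat.mul_le_mul_left (3 * N.choose 3) hz
  have h6 := Nat.mul_le_mul_left (2 * (n + 2).choose 2) ht3
  nlinarith

theorem exists_mem_filter {ι : Type*} [Fintype ι] {S : ι → Set Plane}
    (hne : ∀ i, (S i).Nonempty) [∀ z, DecidablePred fun i => z ∈ S i] (i : ι) :
    ∃ z, 1 ≤ (Finset.univ.filter fun i => z ∈ S i).card := by
  obtain ⟨z, hz⟩ := hne i
  exact ⟨z, Finset.card_pos.2 ⟨i, by simpa using hz⟩⟩

/-- If all pairs meet on the curve, then some point is common to a positive fraction of the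
family. -/
theorem exists_deep_point_of_pairwise {X : Set Plane} (hX : IsConvexCurve X) {ι : Type*} [Fintype ι]
    [LinearOrder ι] {S : ι → Set Plane} (hc : ∀ i, Convex ℝ (S i)) (hK : ∀ i, IsCompact (S i))
    (hne : ∀ i, (S i).Nonempty) [∀ z, DecidablePred fun i => z ∈ S i]
    (h : ∀ i j, i ≠ j → ∃ x ∈ X, x ∈ S i ∧ x ∈ S j) :
    ∃ z, Fintype.card ι ≤ 1587 * (Finset.univ.filter fun i => z ∈ S i).card := by
  have hall : ∀ U : Finset ι, (meeting X S 2 U).card = U.card.choose 2 := by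
    intro U
    rw [← Finset.card_powersetCard]
    congr 1
    ext e
    rw [mem_meeting, Finset.mem_powersetCard]
    refine ⟨fun he => he.1, fun he => ⟨he, ?_⟩⟩
    obtain ⟨i, j, hij, rfl⟩ := Finset.card_eq_two.1 he.2
    obtain ⟨x, hx, hxi, hxj⟩ := h i j hij
    exact ⟨x, hx, by simp [hxi, hxj]⟩
  rcases isEmpty_or_nonempty ι with hι | ⟨⟨i₀⟩⟩
  · exact ⟨0, by simp⟩
  obtain ⟨c, V, -, hV, hcard⟩ := exists_vertical_line (X := X) (S := S) Finset.univ
  rw [hall, Finset.card_univ] at hcard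
  have hn : 0 < Fintype.card ι := Fintype.card_pos_iff.2 ⟨i₀⟩
  have hVn : Fintype.card ι ≤ 2 * V.card + 1 := by
    have h1 := Nat.choose_succ_right_eq (Fintype.card ι) 1
    rw [Nat.choose_one_right] at h1
    obtain ⟨n, hn'⟩ : ∃ n, Fintype.card ι = n + 1 := ⟨Fintype.card ι - 1, by omega⟩
    rw [hn'] at h1 hcard ⊢
    have : (n + 1) * n ≤ (n + 1) * (2 * V.card) := by
      simp only [Nat.add_sub_cancel] at h1
      linarith
    have := Nat.le_of_mul_le_mul_left this (Nat.succ_pos n)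
    omega
  by_cases h36 : 36 ≤ V.card
  · have ht : ∀ U ⊆ V, U.card = 36 → 54 ≤ (meeting Set.univ S 3 U).card := by
      intro U hUV hU
      have h1 := card_meeting_two_le hX hc U c (fun i hi => hV i (hUV hi)) 6
      rw [hall, hU, show Nat.choose 36 2 = 630 by decide] at h1
      omega
    obtain ⟨z, hz⟩ := exists_deep_point_of_forall_subset hc hK V (by norm_num) h36 (by norm_num) ht
    refine ⟨z, ?_⟩
    have h1 : (V.filter fun i => z ∈ S i).card ≤ (Finset.univ.filter fun i => z ∈ S i).card :=
      Finset.card_le_card (Finset.filter_subset_filter _ (Finset.subset_univ V))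
    rw [show Nat.choose 36 3 = 7140 by decide] at hz
    omega
  · obtain ⟨z, hz⟩ := exists_mem_filter hne i₀
    exact ⟨z, by omega⟩

theorem card_mul_pred_le {ι : Type*} [DecidableEq ι] {Y : Set Plane} {S : ι → Set Plane} {p : ℕ}
    (hp : 2 ≤ p) (W : Finset ι) (hW : 2 * p ≤ W.card)
    (h : ∀ T : Finset ι, T.card = p → (meeting Y S 2 T).Nonempty) :
    W.card * (W.card - 1) ≤ 4 * p * (meeting Y S 2 W).card := by
  have h1 := mul_choose_le_card_meeting (Y := Y) (S := S) (V := W) (k := 2) (m := 2 * p)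
    (t := p + 1) (by omega) hW (fun U _ hU => by
      have := card_le_card_meeting_add (Y := Y) (S := S) U fun T _ hT => h T hT
      omega)
  have h2 := Nat.choose_succ_right_eq W.card 1
  have h3 := Nat.choose_succ_right_eq (2 * p) 1
  rw [Nat.choose_one_right] at h2 h3
  rw [← h2]
  obtain ⟨q, rfl⟩ : ∃ q, p = q + 2 := ⟨p - 2, by omega⟩
  rw [show 2 * (q + 2) - 1 = 2 * q + 3 by omega] at h3
  simp only [Nat.reduceAdd] at h2 h3 ⊢
  set E := (meeting Y S 2 W).card
  set B := W.card.choose 2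
  set D := (2 * (q + 2)).choose 2
  have hD : D = (q + 2) * (2 * q + 3) := by nlinarith
  rw [hD] at h1
  have h4 : (2 * q + 3) * (B * 2) ≤ (2 * q + 3) * (4 * (q + 2) * E) := by nlinarith
  exact Nat.le_of_mul_le_mul_left h4 (by omega)

/-- If among every `p` members two meet on the curve, then some point is common to a fraction of
order `p ^ (-4)` of the family. -/
theorem exists_deep_point_of_pairs {X : Set Plane} (hX : IsConvexCurve X) {ι : Type*} [Fintype ι]
    [LinearOrder ι] {S : ι → Set Plane} (hc : ∀ i, Convex ℝ (S i)) (hK : ∀ i, IsCompact (S i))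
    (hne : ∀ i, (S i).Nonempty) [∀ z, DecidablePred fun i => z ∈ S i] {p : ℕ} (hp : 2 ≤ p)
    (h : ∀ T : Finset ι, T.card = p → (meeting X S 2 T).Nonempty) :
    ∃ z, Fintype.card ι ≤ 40960 * p ^ 4 * (Finset.univ.filter fun i => z ∈ S i).card := by
  rcases isEmpty_or_nonempty ι with hι | ⟨⟨i₀⟩⟩
  · exact ⟨0, by simp⟩
  have hpow : p ≤ p ^ 4 := Nat.le_self_pow (by norm_num) p
  by_cases hn : Fintype.card ι < 2 * p
  · obtain ⟨z, hz⟩ := exists_mem_filter hne i₀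
    refine ⟨z, ?_⟩
    calc Fintype.card ι ≤ 40960 * p ^ 4 * 1 := by omega
      _ ≤ _ := Nat.mul_le_mul_left _ hz
  obtain ⟨c, V, -, hV, hcard⟩ := exists_vertical_line (X := X) (S := S) Finset.univ
  have hE := card_mul_pred_le (Y := X) (S := S) hp Finset.univ
    (by rw [Finset.card_univ]; omega) h
  rw [Finset.card_univ] at hcard hE
  have hVn : Fintype.card ι ≤ 5 * p * V.card := by
    obtain ⟨n, hn'⟩ : ∃ n, Fintype.card ι = n + 1 := ⟨Fintype.card ι - 1, by omega⟩
    rw [hn'] at hE hcard hn ⊢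
    have h1 : (n + 1) * n ≤ (n + 1) * (4 * p * V.card) := by
      have := Nat.mul_le_mul_left (4 * p) hcard
      simp only [Nat.add_sub_cancel] at hE
      linarith
    have h2 := Nat.le_of_mul_le_mul_left h1 (Nat.succ_pos n)
    have h3 : 1 ≤ p * V.card := by
      by_contra h0
      have : p * V.card = 0 := by omega
      rw [mul_assoc, this] at h2
      omega
    linarith
  by_cases hN : (16 * p) ^ 2 ≤ V.card
  · have ht : ∀ U ⊆ V, U.card = (16 * p) ^ 2 → 1024 * p ^ 3 ≤ (meeting Set.univ S 3 U).card := by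
      intro U hUV hU
      have h1 := card_meeting_two_le hX hc U c (fun i hi => hV i (hUV hi)) (16 * p)
      have h2 := card_mul_pred_le (Y := X) (S := S) hp U (by rw [hU]; nlinarith) h
      rw [hU] at h1 h2
      set E := (meeting X S 2 U).card
      set T := (meeting Set.univ S 3 U).card
      have hge : 1 ≤ (16 * p) ^ 2 := Nat.one_le_pow _ _ (by omega)
      zify [hge] at h1 h2 hp ⊢
      have hp0 : (0 : ℤ) < p := by linarith
      have h3 : (64 * ((16 * p) ^ 2 - 1) : ℤ) * p ≤ E := by
        refine le_of_mul_le_mul_left ?_ (by linarith : (0 : ℤ) < 4 * p)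
        linarith
      have h4 : (E : ℤ) ≤ (3 * T + 2) + (16 * p) ^ 3 + (16 * p) ^ 2 * (16 * p + 1) := by
        refine le_of_mul_le_mul_left ?_ (by linarith : (0 : ℤ) < 16 * p)
        linarith
      nlinarith [mul_pos hp0 hp0, mul_pos (mul_pos hp0 hp0) hp0,
        mul_nonneg (mul_pos hp0 hp0).le (sub_nonneg.2 hp)]
    obtain ⟨z, hz⟩ := exists_deep_point_of_forall_subset hc hK V (by nlinarith) hN
      (by positivity) ht
    refine ⟨z, ?_⟩
    have h1 : (V.filter fun i => z ∈ S i).card ≤ (Finset.univ.filter fun i => z ∈ S i).card :=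
      Finset.card_le_card (Finset.filter_subset_filter _ (Finset.subset_univ V))
    set d := (V.filter fun i => z ∈ S i).card
    have h2 : 6 * ((16 * p) ^ 2).choose 3 ≤ ((16 * p) ^ 2) ^ 3 := by
      have := Nat.choose_le_pow_div (α := ℚ) 3 ((16 * p) ^ 2)
      rw [le_div_iff₀ (by positivity)] at this
      have h6 : ((Nat.factorial 3 : ℕ) : ℚ) = 6 := by norm_num [Nat.factorial]
      rw [h6] at this
      have h7 : ((6 * ((16 * p) ^ 2).choose 3 : ℕ) : ℚ) ≤ (((16 * p) ^ 2) ^ 3 : ℕ) := by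
        push_cast at this ⊢
        linarith
      exact_mod_cast h7
    have h3 : V.card ≤ 8192 * p ^ 3 * d := by
      have h4 : 2048 * p ^ 3 * V.card ≤ 2048 * p ^ 3 * (8192 * p ^ 3 * d) := by
        have := Nat.mul_le_mul_right d h2
        ring_nf at this hz ⊢
        linarith
      exact Nat.le_of_mul_le_mul_left h4 (by positivity)
    calc Fintype.card ι ≤ 5 * p * V.card := hVn
      _ ≤ 5 * p * (8192 * p ^ 3 * d) := Nat.mul_le_mul_left _ h3
      _ = 40960 * p ^ 4 * d := by ring
      _ ≤ _ := Nat.mul_le_mul_left _ h1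
  · obtain ⟨z, hz⟩ := exists_mem_filter hne i₀
    refine ⟨z, ?_⟩
    have h1 : 5 * p * V.card ≤ 5 * p * (16 * p) ^ 2 := Nat.mul_le_mul_left _ (by omega)
    have h2 : p ^ 3 ≤ p ^ 4 := Nat.pow_le_pow_right (by omega) (by norm_num)
    calc Fintype.card ι ≤ 5 * p * (16 * p) ^ 2 := hVn.trans h1
      _ = 1280 * p ^ 3 := by ring
      _ ≤ 40960 * p ^ 4 * 1 := by omega
      _ ≤ _ := Nat.mul_le_mul_left _ hz

/-! ### Weak nets -/

/-- A one-dimensional net: few reals suffice to hit every interval that contains at least `κ` of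
the given points. -/
theorem exists_line_net {α : Type*} (y : α → ℝ) {κ : ℝ} (hκ : 0 < κ) (Q : Finset α) :
    ∃ N : Finset ℝ, N.card * κ ≤ Q.card ∧ ∀ (s : Set ℝ) [DecidablePred fun q => y q ∈ s],
      s.OrdConnected → κ ≤ (Q.filter fun q => y q ∈ s).card → ∃ t ∈ N, t ∈ s := by
  classical
  induction Q using Finset.strongInduction with
  | H Q ih =>
    by_cases hlt : (Q.card : ℝ) < κ
    · refine ⟨∅, by simp, fun s _ _ hs => ?_⟩
      have : ((Q.filter fun q => y q ∈ s).card : ℝ) ≤ Q.card := by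
        exact_mod_cast Finset.card_filter_le _ _
      linarith
    · have hQ : Q.Nonempty := by
        rw [← Finset.card_pos]
        have : (0 : ℝ) < Q.card := by linarith
        exact_mod_cast this
      -- the first point `y a` up to which there are `κ` points
      have hA : (Q.filter fun a => κ ≤ (Q.filter fun q => y q ≤ y a).card).Nonempty := by
        obtain ⟨a, ha, hmax⟩ := Finset.exists_max_image Q y hQ
        refine ⟨a, Finset.mem_filter.2 ⟨ha, ?_⟩⟩
        rw [Finset.filter_true_of_mem hmax]
        exact not_lt.1 hlt
      obtain ⟨a, ha, hmin⟩ := Finset.exists_min_image _ y hA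
      obtain ⟨haQ, haκ⟩ := Finset.mem_filter.1 ha
      obtain ⟨N, hN, hNs⟩ := ih (Q.filter fun q => ¬ y q ≤ y a) (by
        refine Finset.filter_ssubset.2 ⟨a, haQ, by simp⟩)
      refine ⟨insert (y a) N, ?_, fun s _ hs hcount => ?_⟩
      · have h1 := Finset.card_filter_add_card_filter_not (s := Q) (fun q => y q ≤ y a)
        have h2 : ((insert (y a) N).card : ℝ) ≤ N.card + 1 := by
          exact_mod_cast Finset.card_insert_le _ _
        have h3 : (((Q.filter fun q => y q ≤ y a).card : ℕ) : ℝ) +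
            ((Q.filter fun q => ¬ y q ≤ y a).card : ℕ) = Q.card := by exact_mod_cast h1
        nlinarith
      · by_cases has : y a ∈ s
        · exact ⟨y a, Finset.mem_insert_self _ _, has⟩
        by_cases hex : ∃ q ∈ Q, y q ∈ s ∧ y q ≤ y a
        · obtain ⟨q, hq, hqs, hqa⟩ := hex
          exfalso
          have hbelow : ∀ r, y r ∈ s → y r < y a := by
            intro r hr
            by_contra hra
            exact has (hs.out hqs hr ⟨hqa, not_lt.1 hra⟩)
          obtain ⟨b, hb, hbmax⟩ := Finset.exists_max_image (Q.filter fun q => y q ∈ s) y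
            ⟨q, Finset.mem_filter.2 ⟨hq, hqs⟩⟩
          obtain ⟨hbQ, hbs⟩ := Finset.mem_filter.1 hb
          refine absurd (hmin b (Finset.mem_filter.2 ⟨hbQ, hcount.trans ?_⟩))
            (not_le.2 (hbelow b hbs))
          have hsub : (Q.filter fun q => y q ∈ s) ⊆ Q.filter fun q => y q ≤ y b := fun r hr =>
            Finset.mem_filter.2 ⟨(Finset.mem_filter.1 hr).1, hbmax r hr⟩
          exact_mod_cast Finset.card_le_card hsub
        · obtain ⟨t, ht, hts⟩ := hNs s hs (hcount.trans (by
            have hsub : (Q.filter fun q => y q ∈ s) ⊆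
                (Q.filter fun q => ¬ y q ≤ y a).filter fun q => y q ∈ s := by
              intro r hr
              obtain ⟨hrQ, hrs⟩ := Finset.mem_filter.1 hr
              exact Finset.mem_filter.2 ⟨Finset.mem_filter.2
                ⟨hrQ, fun hle => hex ⟨r, hrQ, hrs, hle⟩⟩, hrs⟩
            exact_mod_cast Finset.card_le_card hsub))
          exact ⟨t, Finset.mem_insert_of_mem ht, hts⟩

theorem exists_lower_subset {α : Type*} [DecidableEq α] (f : α → ℝ) (V : Finset α) (m : ℕ)
    (hm : m ≤ V.card) : ∃ V₁ ⊆ V, V₁.card = m ∧ ∀ u ∈ V₁, ∀ v ∈ V \ V₁, f u ≤ f v := by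
  induction m with
  | zero => exact ⟨∅, by simp, by simp, by simp⟩
  | succ m ih =>
    obtain ⟨V₁, hV₁, hcard, hle⟩ := ih (by omega)
    have hne : (V \ V₁).Nonempty := by
      rw [← Finset.card_pos, Finset.card_sdiff_of_subset hV₁]
      omega
    obtain ⟨a, ha, hmin⟩ := Finset.exists_min_image _ f hne
    obtain ⟨haV, haV₁⟩ := Finset.mem_sdiff.1 ha
    refine ⟨insert a V₁, Finset.insert_subset haV hV₁, by
      rw [Finset.card_insert_of_notMem haV₁, hcard], ?_⟩
    intro u hu v hv
    obtain ⟨hvV, hvn⟩ := Finset.mem_sdiff.1 hv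
    have hv' : v ∈ V \ V₁ :=
      Finset.mem_sdiff.2 ⟨hvV, fun h => hvn (Finset.mem_insert_of_mem h)⟩
    rcases Finset.mem_insert.1 hu with rfl | hu
    · exact hmin v hv'
    · exact hle u hu v hv'

/-- Weak nets in the plane. A vertical line halves the points. A convex set either contains
three quarters of its points on one side, and recursion applies with a better ratio, or it meets the
line in an interval containing many crossing points of segments joining the two halves. -/
theorem exists_weak_net {α : Type*} (x : α → Plane) (V : Finset α) {k : ℝ} (hk : 0 < k) :
    ∃ N : Finset Plane, N.card * k ^ 2 ≤ 40 * (V.card : ℝ) ^ 2 ∧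
      ∀ (C : Set Plane) [DecidablePred fun v => x v ∈ C], Convex ℝ C →
        k ≤ (V.filter fun v => x v ∈ C).card → ∃ z ∈ N, z ∈ C := by
  classical
  induction V using Finset.strongInduction generalizing k with
  | H V ih =>
    by_cases hlt : (V.card : ℝ) < k
    · refine ⟨∅, by simp, fun C _ _ hC => ?_⟩
      have : ((V.filter fun v => x v ∈ C).card : ℝ) ≤ V.card := by
        exact_mod_cast Finset.card_filter_le _ _
      linarith
    by_cases hsmall : V.card ≤ 40
    · refine ⟨V.image x, ?_, fun C _ _ hC => ?_⟩
      · have h1 : ((V.image x).card : ℝ) ≤ V.card := by exact_mod_cast Finset.card_image_le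
        have h2 : (V.card : ℝ) ≤ 40 := by exact_mod_cast hsmall
        have h3 : k ^ 2 ≤ (V.card : ℝ) ^ 2 := by
          have := not_lt.1 hlt
          gcongr
        exact mul_le_mul (h1.trans h2) h3 (by positivity) (by norm_num)
      · have : 0 < (V.filter fun v => x v ∈ C).card := by
          have : (0 : ℝ) < (V.filter fun v => x v ∈ C).card := by linarith
          exact_mod_cast this
        obtain ⟨v, hv⟩ := Finset.card_pos.1 this
        obtain ⟨hvV, hvC⟩ := Finset.mem_filter.1 hv
        exact ⟨x v, Finset.mem_image_of_mem x hvV, hvC⟩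
    obtain ⟨V₁, hV₁, hV₁card, hle⟩ := exists_lower_subset (fun v => x v 0) V (V.card / 2)
      (Nat.div_le_self _ _)
    have hV₂card := Finset.card_sdiff_of_subset hV₁
    set V₂ := V \ V₁ with hV₂
    have hV₁ne : V₁.Nonempty := Finset.card_pos.1 (by omega)
    have hss₁ : V₁ ⊂ V := Finset.ssubset_iff_subset_ne.2 ⟨hV₁, fun h => by
      rw [h] at hV₁card; omega⟩
    have hss₂ : V₂ ⊂ V := Finset.sdiff_ssubset hV₁ hV₁ne
    obtain ⟨N₁, hN₁, hit₁⟩ := ih V₁ hss₁ (k := 3 * k / 4) (by positivity)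
    obtain ⟨N₂, hN₂, hit₂⟩ := ih V₂ hss₂ (k := 3 * k / 4) (by positivity)
    obtain ⟨a, haV₁, hamax⟩ := Finset.exists_max_image V₁ (fun v => x v 0) hV₁ne
    set c := x a 0 with hc
    have hcross : ∀ q : α × α, ∃ z : Plane, q ∈ V₁ ×ˢ V₂ →
        z ∈ segment ℝ (x q.1) (x q.2) ∧ z 0 = c := by
      intro q
      by_cases hq : q ∈ V₁ ×ˢ V₂
      · obtain ⟨h1, h2⟩ := Finset.mem_product.1 hq
        have hcont : Continuous fun z : Plane => z 0 := by fun_prop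
        obtain ⟨z, hz, hzc⟩ := (convex_segment (x q.1) (x q.2)).isPreconnected.intermediate_value
          (left_mem_segment ℝ _ _) (right_mem_segment ℝ _ _) hcont.continuousOn
          (show c ∈ Set.Icc (x q.1 0) (x q.2 0) from ⟨hamax _ h1, hle a haV₁ _ h2⟩)
        exact ⟨z, fun _ => ⟨hz, hzc⟩⟩
      · exact ⟨0, fun h => absurd h hq⟩
    choose z hz using hcross
    obtain ⟨N₃, hN₃, hit₃⟩ := exists_line_net (fun q => z q 1) (κ := k ^ 2 / 16) (by positivity)
      (V₁ ×ˢ V₂)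
    refine ⟨N₁ ∪ N₂ ∪ N₃.image fun t => !₂[c, t], ?_, fun C _ hC hcount => ?_⟩
    · have h1 : ((N₁ ∪ N₂ ∪ N₃.image fun t => !₂[c, t]).card : ℝ) ≤ N₁.card + N₂.card + N₃.card := by
        have h1 := Finset.card_union_le (N₁ ∪ N₂) (N₃.image fun t => (!₂[c, t] : Plane))
        have h2 := Finset.card_union_le N₁ N₂
        have h3 : (N₃.image fun t => (!₂[c, t] : Plane)).card ≤ N₃.card := Finset.card_image_le
        exact_mod_cast (by omega : (N₁ ∪ N₂ ∪ N₃.image fun t => (!₂[c, t] : Plane)).card ≤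
          N₁.card + N₂.card + N₃.card)
      rw [Finset.card_product] at hN₃
      push_cast at hN₃
      have hsum : (V₁.card : ℝ) + V₂.card = V.card := by
        exact_mod_cast (by omega : V₁.card + V₂.card = V.card)
      have hdiff1 : (V₁.card : ℝ) ≤ V₂.card := by
        exact_mod_cast (by omega : V₁.card ≤ V₂.card)
      have hdiff2 : (V₂.card : ℝ) ≤ V₁.card + 1 := by
        exact_mod_cast (by omega : V₂.card ≤ V₁.card + 1)
      have hW : (40 : ℝ) < V.card := by exact_mod_cast (by omega : 40 < V.card)
      set w₁ : ℝ := (V₁.card : ℝ)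
      set w₂ : ℝ := (V₂.card : ℝ)
      rw [← hsum] at hW ⊢
      have hk2 : 0 < k ^ 2 := by positivity
      have h2 : (w₂ - w₁) ^ 2 ≤ 1 := by nlinarith
      have h3 := mul_le_mul_of_nonneg_right h1 hk2.le
      nlinarith
    · have hsplit : (V.filter fun v => x v ∈ C).card =
          (V₁.filter fun v => x v ∈ C).card + (V₂.filter fun v => x v ∈ C).card := by
        rw [← Finset.card_union_of_disjoint, ← Finset.filter_union, hV₂,
          Finset.union_sdiff_of_subset hV₁]
        exact Finset.disjoint_filter_filter Finset.disjoint_sdiff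
      rw [hsplit] at hcount
      push_cast at hcount
      by_cases h1 : 3 * k / 4 ≤ (V₁.filter fun v => x v ∈ C).card
      · obtain ⟨y, hy, hyC⟩ := hit₁ C hC h1
        exact ⟨y, by simp [hy], hyC⟩
      by_cases h2 : 3 * k / 4 ≤ (V₂.filter fun v => x v ∈ C).card
      · obtain ⟨y, hy, hyC⟩ := hit₂ C hC h2
        exact ⟨y, by simp [hy], hyC⟩
      have hzeq : ∀ q ∈ V₁ ×ˢ V₂, (!₂[c, z q 1] : Plane) = z q := by
        intro q hq
        exact Plane.ext_coord (by simp [(hz q hq).2]) (by simp)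
      have hord : {t : ℝ | (!₂[c, t] : Plane) ∈ C}.OrdConnected := by
        apply Convex.ordConnected
        intro s hs t ht α β hα hβ hαβ
        have := hC hs ht hα hβ hαβ
        simp only [Set.mem_ofPred_eq]
        convert this using 1
        refine Plane.ext_coord ?_ (by simp)
        simp [← add_mul, hαβ]
      obtain ⟨t, ht, htC⟩ := hit₃ {t : ℝ | (!₂[c, t] : Plane) ∈ C} hord (by
        have hsub : (V₁.filter fun v => x v ∈ C) ×ˢ (V₂.filter fun v => x v ∈ C) ⊆
            (V₁ ×ˢ V₂).filter fun q => z q 1 ∈ {t : ℝ | (!₂[c, t] : Plane) ∈ C} := by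
          intro q hq
          obtain ⟨hq1, hq2⟩ := Finset.mem_product.1 hq
          obtain ⟨hq1, hq1C⟩ := Finset.mem_filter.1 hq1
          obtain ⟨hq2, hq2C⟩ := Finset.mem_filter.1 hq2
          have hq' : q ∈ V₁ ×ˢ V₂ := Finset.mem_product.2 ⟨hq1, hq2⟩
          refine Finset.mem_filter.2 ⟨hq', ?_⟩
          simp only [Set.mem_ofPred_eq]
          rw [hzeq q hq']
          exact hC.segment_subset hq1C hq2C (hz q hq').1
        have h3 := Finset.card_le_card hsub
        rw [Finset.card_product] at h3
        have h4 : ((V₁.filter fun v => x v ∈ C).card : ℝ) * (V₂.filter fun v => x v ∈ C).card ≤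
            ((V₁ ×ˢ V₂).filter fun q => z q 1 ∈ {t : ℝ | (!₂[c, t] : Plane) ∈ C}).card := by
          exact_mod_cast h3
        refine le_trans ?_ h4
        have h5 : k / 4 ≤ (V₁.filter fun v => x v ∈ C).card := by linarith
        have h6 : k / 4 ≤ (V₂.filter fun v => x v ∈ C).card := by linarith
        have := mul_le_mul h5 h6 (by positivity) (by positivity)
        linarith)
      exact ⟨_, by simp only [Finset.mem_union, Finset.mem_image]; exact Or.inr ⟨t, ht, rfl⟩, htC⟩

/-! ### From deep points to transversals -/

theorem exists_deep_point_weighted {ι : Type*} [Fintype ι] {S : ι → Set Plane}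
    [∀ z, DecidablePred fun i => z ∈ S i] {c : ℝ}
    (h : ∀ (m : ℕ) (σ : Fin m → ι), ∃ z, c * m ≤ (Finset.univ.filter fun t => z ∈ S (σ t)).card)
    (w : ι → ℕ) : ∃ z, c * ∑ i, (w i : ℝ) ≤ ∑ i with z ∈ S i, (w i : ℝ) := by
  classical
  have e := Fintype.equivFin (Σ i, Fin (w i))
  obtain ⟨z, hz⟩ := h _ fun t => (e.symm t).1
  have hcard : (Finset.univ.filter fun t => z ∈ S (e.symm t).1).card = ∑ i with z ∈ S i, w i := by
    have h1 : (Finset.univ.filter fun t => z ∈ S (e.symm t).1).card =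
        ((Finset.univ.filter fun i => z ∈ S i).sigma fun i => (Finset.univ : Finset (Fin (w i)))).card := by
      refine Finset.card_equiv e.symm fun t => ?_
      simp
    rw [h1, Finset.card_sigma]
    simp
  refine ⟨z, ?_⟩
  rw [hcard, Fintype.card_sigma] at hz
  simpa using hz

/-- Reweighting: repeatedly take a deep point with respect to the current weights and double the
weights of the members it misses. As the total weight grows slowly, no member is missed often. -/
theorem exists_sequence {ι : Type*} [Fintype ι] {S : ι → Set Plane}
    [∀ z, DecidablePred fun i => z ∈ S i] {c : ℝ} (hc : c ≤ 1)
    (h : ∀ w : ι → ℕ, ∃ z, c * ∑ i, (w i : ℝ) ≤ ∑ i with z ∈ S i, (w i : ℝ)) (T : ℕ) :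
    ∃ z : ℕ → Plane, ∑ i, (2 : ℝ) ^ ((Finset.range T).filter fun t => z t ∉ S i).card ≤
      Fintype.card ι * (2 - c) ^ T := by
  classical
  induction T with
  | zero => exact ⟨0, by simp⟩
  | succ T ih =>
    obtain ⟨z, hz⟩ := ih
    set u : ι → ℕ := fun i => ((Finset.range T).filter fun t => z t ∉ S i).card with hu
    obtain ⟨y, hy⟩ := h fun i => 2 ^ u i
    push_cast at hy
    refine ⟨Function.update z T y, ?_⟩
    have hstep : ∀ i, (2 : ℝ) ^ ((Finset.range (T + 1)).filter fun t =>
        Function.update z T y t ∉ S i).card = 2 * 2 ^ u i - if y ∈ S i then 2 ^ u i else 0 := by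
      intro i
      have hcongr : ((Finset.range T).filter fun t => Function.update z T y t ∉ S i) =
          (Finset.range T).filter fun t => z t ∉ S i := by
        refine Finset.filter_congr fun t ht => ?_
        rw [Function.update_of_ne (Finset.mem_range.1 ht).ne]
      rw [Finset.range_add_one, Finset.filter_insert, hcongr, Function.update_self]
      by_cases hyi : y ∈ S i
      · simp [hyi, hu]; ring
      · rw [if_pos hyi, if_neg hyi, Finset.card_insert_of_notMem (by simp), pow_succ]
        ring
    rw [Finset.sum_congr rfl fun i _ => hstep i, Finset.sum_sub_distrib, ← Finset.mul_sum,
      ← Finset.sum_filter]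
    calc _ ≤ (2 - c) * ∑ i, (2 : ℝ) ^ u i := by linarith
      _ ≤ (2 - c) * (Fintype.card ι * (2 - c) ^ T) :=
        mul_le_mul_of_nonneg_left hz (by linarith)
      _ = _ := by ring

/-- If for all choices of multiplicities some point is common to a fraction `c` of the family, then
the family has a transversal of size at most `160 / c ^ 2`. -/
theorem exists_transversal {ι : Type*} [Fintype ι] {S : ι → Set Plane}
    (hS : ∀ i, Convex ℝ (S i)) {c : ℝ} (hc0 : 0 < c) (hc1 : c ≤ 1)
    [∀ z, DecidablePred fun i => z ∈ S i]
    (h : ∀ (m : ℕ) (σ : Fin m → ι), ∃ z, c * m ≤ (Finset.univ.filter fun t => z ∈ S (σ t)).card) :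
    ∃ N : Finset Plane, (∀ i, ∃ z ∈ N, z ∈ S i) ∧ (N.card : ℝ) ≤ 160 / c ^ 2 := by
  classical
  -- by Bernoulli's inequality, `r < 1`
  set r : ℝ := (1 - c / 2) * 2 ^ (c / 2) with hr
  have hr0 : 0 ≤ r := mul_nonneg (by linarith) (by positivity)
  have hr1 : r < 1 := by
    have h1 : (2 : ℝ) ^ (c / 2) ≤ 1 + c / 2 := by
      have := rpow_one_add_le_one_add_mul_self (s := 1) (by norm_num) (p := c / 2)
        (by linarith) (by linarith)
      norm_num at this ⊢
      linarith
    calc r ≤ (1 - c / 2) * (1 + c / 2) := mul_le_mul_of_nonneg_left h1 (by linarith)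
      _ < 1 := by nlinarith
  obtain ⟨T, hT1, hT⟩ : ∃ T : ℕ, 0 < T ∧ Fintype.card ι * r ^ T < 1 := by
    have h1 : Filter.Tendsto (fun T : ℕ => (Fintype.card ι : ℝ) * r ^ T) Filter.atTop (nhds 0) := by
      simpa using (tendsto_pow_atTop_nhds_zero_of_lt_one hr0 hr1).const_mul (Fintype.card ι : ℝ)
    obtain ⟨T, h2, h3⟩ := ((h1.eventually_lt_const one_pos).and
      (Filter.eventually_gt_atTop 0)).exists
    exact ⟨T, h3, h2⟩
  obtain ⟨z, hz⟩ := exists_sequence hc1 (exists_deep_point_weighted h) T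
  have hTpos : (0 : ℝ) < T := by exact_mod_cast hT1
  have hcov : ∀ i, c / 2 * T ≤ ((Finset.range T).filter fun t => z t ∈ S i).card := by
    intro i
    by_contra hlt
    have hsum := Finset.card_filter_add_card_filter_not (s := Finset.range T) (fun t => z t ∈ S i)
    rw [Finset.card_range] at hsum
    set u := ((Finset.range T).filter fun t => z t ∉ S i).card with hu
    have hu' : (1 - c / 2) * T ≤ u := by
      have : (((Finset.range T).filter fun t => z t ∈ S i).card : ℝ) + u = T := by
        exact_mod_cast hsum
      linarith
    have h1 : (2 : ℝ) ^ u ≤ Fintype.card ι * (2 - c) ^ T :=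
      (Finset.single_le_sum (f := fun i => (2 : ℝ) ^ ((Finset.range T).filter
        fun t => z t ∉ S i).card) (fun i _ => by positivity) (Finset.mem_univ i)).trans hz
    have h2 : (2 : ℝ) ^ ((1 - c / 2) * T) ≤ 2 ^ u := by
      rw [← Real.rpow_natCast]
      exact Real.rpow_le_rpow_of_exponent_le (by norm_num) hu'
    have h3 : (2 : ℝ) ^ ((1 - c / 2) * T) * (2 ^ (c / 2)) ^ T = 2 ^ T := by
      rw [← Real.rpow_natCast, ← Real.rpow_natCast, ← Real.rpow_mul (by norm_num),
        ← Real.rpow_add (by norm_num)]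
      congr 1; ring
    have h4 : (2 - c) ^ T * (2 ^ (c / 2)) ^ T = 2 ^ T * r ^ T := by
      rw [← mul_pow, ← mul_pow, hr]
      congr 1; ring
    have h5 := mul_le_mul_of_nonneg_right (h2.trans h1)
      (by positivity : (0 : ℝ) ≤ ((2 : ℝ) ^ (c / 2)) ^ T)
    rw [h3, mul_assoc, h4] at h5
    have h6 : (0 : ℝ) < 2 ^ T := by positivity
    nlinarith
  obtain ⟨N, hN, hit⟩ := exists_weak_net z (Finset.range T) (k := c / 2 * T) (by positivity)
  refine ⟨N, fun i => hit (S i) (hS i) (hcov i), ?_⟩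
  rw [Finset.card_range] at hN
  rw [le_div_iff₀ (by positivity)]
  have hT2 : (0 : ℝ) < T ^ 2 := by positivity
  refine le_of_mul_le_mul_right ?_ hT2
  nlinarith

/-! ### The two parts of the theorem -/

open Classical in
theorem ncard_eq_card_filter {n : ℕ} (S : Fin n → ConvexBody Plane) (z : Plane) :
    {i : Fin n | z ∈ S i}.ncard = (Finset.univ.filter fun i => z ∈ (S i : Set Plane)).card := by
  rw [← Set.ncard_coe_finset]
  congr 1
  ext i
  simp

theorem meeting_nonempty_of_pair {ι : Type*} [DecidableEq ι] {X : Set Plane} {S : ι → Set Plane}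
    {T : Finset ι} {i j : ι} (hi : i ∈ T) (hj : j ∈ T) (hij : i ≠ j) {x : Plane} (hx : x ∈ X)
    (hxi : x ∈ S i) (hxj : x ∈ S j) : (meeting X S 2 T).Nonempty :=
  ⟨{i, j}, mem_meeting.2 ⟨⟨by
    intro k hk
    simp only [Finset.mem_insert, Finset.mem_singleton] at hk
    rcases hk with rfl | rfl <;> assumption, Finset.card_pair hij⟩, x, hx, by simp [hxi, hxj]⟩⟩

open Classical in
theorem exists_transversal_of_pairwise {X : Set Plane} (hX : IsConvexCurve X) {n : ℕ}
    (S : Fin n → ConvexBody Plane) (h : ∀ i j : Fin n, i ≠ j → MeetOn X (S i) (S j)) :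
    ∃ N : Finset Plane, IsTransversal S N ∧ (N.card : ℝ) ≤ 1.75 * 10 ^ 9 := by
  rcases le_or_gt n 1 with hn | hn
  · have hsub : Subsingleton (Fin n) := Fin.subsingleton_iff_le_one.2 hn
    choose q hq using fun i => (S i).nonempty
    refine ⟨Finset.univ.image q, fun i => ⟨q i, by simp, hq i⟩, ?_⟩
    have h1 : (Finset.univ.image q).card ≤ n := Finset.card_image_le.trans (by simp)
    have h2 : ((Finset.univ.image q).card : ℝ) ≤ 1 := by exact_mod_cast h1.trans hn
    linarith
  · have : Nontrivial (Fin n) := Fin.nontrivial_iff_two_le.2 hn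
    obtain ⟨N, hN, hcard⟩ := exists_transversal (S := fun i => (S i : Set Plane))
      (fun i => (S i).convex) (c := 1 / 1587) (by norm_num) (by norm_num) (by
        intro m σ
        obtain ⟨z, hz⟩ := exists_deep_point_of_pairwise hX (S := fun t => (S (σ t) : Set Plane))
          (fun t => (S _).convex) (fun t => (S _).isCompact) (fun t => (S _).nonempty) (by
            intro t t' _
            -- a repeated member meets itself on `X`, because it meets some other member there
            by_cases heq : σ t = σ t'
            · obtain ⟨j, hj⟩ := exists_ne (σ t)
              obtain ⟨x, hx, -, hxt⟩ := h j (σ t) hj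
              exact ⟨x, hx, hxt, heq ▸ hxt⟩
            · exact h _ _ heq)
        refine ⟨z, ?_⟩
        rw [Fintype.card_fin] at hz
        have hz' : (m : ℝ) ≤ 1587 * (Finset.univ.filter fun t => z ∈ (S (σ t) : Set Plane)).card := by
          exact_mod_cast hz
        linarith)
    exact ⟨N, hN, hcard.trans (by norm_num)⟩

open Classical in
theorem exists_transversal_of_pairCondition {X : Set Plane} (hX : IsConvexCurve X) {p : ℕ}
    (hp : 2 ≤ p) {n : ℕ} (S : Fin n → ConvexBody Plane) (h : PairConditionOn X S p) :
    ∃ N : Finset Plane, IsTransversal S N ∧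
      (N.card : ℝ) ≤ (160 * 40960 ^ 2 + 1) * (p : ℝ) ^ 8 := by
  have hp1 : (1 : ℝ) ≤ p := by exact_mod_cast (by omega : 1 ≤ p)
  have hp4 : (1 : ℝ) ≤ (p : ℝ) ^ 4 := one_le_pow₀ hp1
  set c : ℝ := 1 / (40960 * (p : ℝ) ^ 4) with hc
  have hc0 : 0 < c := by positivity
  have hc1 : c ≤ 1 := by
    rw [hc, div_le_one (by positivity)]
    linarith
  -- the members that meet `X`; with repetitions they still satisfy the condition on pairs
  set G : Set (Fin n) := {i | ∃ x ∈ X, x ∈ S i} with hG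
  obtain ⟨N, hN, hcard⟩ := exists_transversal (ι := G) (S := fun i => (S i : Set Plane))
    (fun i => (S i).convex) hc0 hc1 (by
      intro m σ
      obtain ⟨z, hz⟩ := exists_deep_point_of_pairs hX (S := fun t => (S (σ t) : Set Plane))
        (fun t => (S _).convex) (fun t => (S _).isCompact) (fun t => (S _).nonempty) hp (by
          intro T hT
          by_cases hinj : Set.InjOn (fun t => (σ t : Fin n)) T
          · obtain ⟨i, hi, j, hj, hij, x, hx, hxi, hxj⟩ :=
              h (T.image fun t => (σ t : Fin n)) (by rw [Finset.card_image_of_injOn hinj, hT])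
            obtain ⟨t, ht, rfl⟩ := Finset.mem_image.1 hi
            obtain ⟨t', ht', rfl⟩ := Finset.mem_image.1 hj
            exact meeting_nonempty_of_pair ht ht' (fun e => hij (by rw [e])) hx hxi hxj
          · simp only [Set.InjOn, not_forall] at hinj
            obtain ⟨t, ht, t', ht', heq, hne⟩ := hinj
            obtain ⟨x, hx, hxt⟩ := (σ t).2
            exact meeting_nonempty_of_pair ht ht' hne hx hxt (heq ▸ hxt))
      refine ⟨z, ?_⟩
      rw [Fintype.card_fin] at hz
      have hz' : (m : ℝ) ≤ 40960 * (p : ℝ) ^ 4 *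
          (Finset.univ.filter fun t => z ∈ (S (σ t) : Set Plane)).card := by exact_mod_cast hz
      rw [hc, one_div_mul_eq_div, div_le_iff₀ (by positivity)]
      linarith)
  choose q hq using fun i => (S i).nonempty
  have hB : (Finset.univ.filter fun i => i ∉ G).card < p := by
    by_contra hge
    obtain ⟨T, hTB, hT⟩ := Finset.exists_subset_card_eq (not_lt.1 hge)
    obtain ⟨i, hi, j, -, -, x, hx, hxi, -⟩ := h T hT
    exact (Finset.mem_filter.1 (hTB hi)).2 ⟨x, hx, hxi⟩
  refine ⟨N ∪ (Finset.univ.filter fun i => i ∉ G).image q, ?_, ?_⟩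
  · intro i
    by_cases hi : i ∈ G
    · obtain ⟨z, hz, hzi⟩ := hN ⟨i, hi⟩
      exact ⟨z, Finset.mem_union_left _ hz, hzi⟩
    · exact ⟨q i, Finset.mem_union_right _ (Finset.mem_image_of_mem q (by simp [hi])), hq i⟩
  · have h1 : (N ∪ (Finset.univ.filter fun i => i ∉ G).image q).card ≤ N.card + p :=
      (Finset.card_union_le _ _).trans
        (Nat.add_le_add_left (Finset.card_image_le.trans hB.le) _)
    have h2 : ((N ∪ (Finset.univ.filter fun i => i ∉ G).image q).card : ℝ) ≤ N.card + p := by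
      exact_mod_cast h1
    have h3 : 160 / c ^ 2 = 160 * 40960 ^ 2 * (p : ℝ) ^ 8 := by
      rw [hc]
      field_simp
    have h4 : (p : ℝ) ≤ (p : ℝ) ^ 8 := le_self_pow₀ hp1 (by norm_num)
    rw [h3] at hcard
    linarith

theorem theorem1 :
    (∀ (X : Set Plane), IsConvexCurve X →
      ∀ (n : ℕ) (S : Fin n → ConvexBody Plane),
        (∀ i j : Fin n, i ≠ j → MeetOn X (S i) (S j)) →
          (∃ z : Plane, (1 / 15800 : ℝ) * (n : ℝ) ≤ ({i : Fin n | z ∈ S i}.ncard : ℝ)) ∧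
          (∃ N : Finset Plane, IsTransversal S N ∧ (N.card : ℝ) ≤ 1.75 * 10 ^ 9)) ∧
    (∃ c : ℝ, 0 < c ∧ ∃ C : ℝ, 0 < C ∧
      ∀ (p : ℕ), 2 ≤ p →
      ∀ (X : Set Plane), IsConvexCurve X →
      ∀ (n : ℕ) (S : Fin n → ConvexBody Plane), PairConditionOn X S p →
          (∃ z : Plane, c / (p : ℝ) ^ 4 * (n : ℝ) ≤ ({i : Fin n | z ∈ S i}.ncard : ℝ)) ∧
          (∃ N : Finset Plane, IsTransversal S N ∧ (N.card : ℝ) ≤ C * (p : ℝ) ^ 8)) := by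
  classical
  refine ⟨fun X hX n S h => ⟨?_, exists_transversal_of_pairwise hX S h⟩,
    1 / 40960, by norm_num, 160 * 40960 ^ 2 + 1, by norm_num, fun p hp X hX n S h =>
      ⟨?_, exists_transversal_of_pairCondition hX hp S h⟩⟩
  · obtain ⟨z, hz⟩ := exists_deep_point_of_pairwise hX (S := fun i => (S i : Set Plane))
      (fun i => (S i).convex) (fun i => (S i).isCompact) (fun i => (S i).nonempty) h
    refine ⟨z, ?_⟩
    rw [Fintype.card_fin] at hz
    rw [ncard_eq_card_filter]
    have hz' : (n : ℝ) ≤ 1587 * (Finset.univ.filter fun i => z ∈ (S i : Set Plane)).card := by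
      exact_mod_cast hz
    have h0 : (0 : ℝ) ≤ (Finset.univ.filter fun i => z ∈ (S i : Set Plane)).card := by positivity
    linarith
  · obtain ⟨z, hz⟩ := exists_deep_point_of_pairs hX (S := fun i => (S i : Set Plane))
      (fun i => (S i).convex) (fun i => (S i).isCompact) (fun i => (S i).nonempty) hp (by
        intro T hT
        obtain ⟨i, hi, j, hj, hij, x, hx, hxi, hxj⟩ := h T hT
        exact meeting_nonempty_of_pair hi hj hij hx hxi hxj)
    refine ⟨z, ?_⟩
    rw [Fintype.card_fin] at hz
    rw [ncard_eq_card_filter]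
    have hz' : (n : ℝ) ≤ 40960 * (p : ℝ) ^ 4 *
        (Finset.univ.filter fun i => z ∈ (S i : Set Plane)).card := by exact_mod_cast hz
    have hp0 : (0 : ℝ) < p := by exact_mod_cast (by omega : 0 < p)
    rw [div_div, one_div_mul_eq_div, div_le_iff₀ (by positivity)]
    linarith
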